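/- **Notation.** For a real vector space $V$ of dimension $n\ge 1$, a *unit ball* in $V$ is a compact convex set $B\subset V$ with $B=-B$ and non-empty interior, and $\mathcal K(V)$ is the set of non-empty compact convex subsets of $V$. Let $\omega_n$ be the volume of the $n$-dimensional Euclidean unit ball. Fix a volume form $\Omega$ on $V$ with associated Lebesgue measure $\mathrm{vol}$; let $V_1(L,B)=V(L,\dots,L,B)$ denote the mixed volume with $n-1$ copies of $L$ and one copy of $B$. The projection body $\Pi L\subset V^*$ of $L\in\mathcal K(V)$ is the compact convex set with support function $h(\Pi L,v)=\mathrm{vol}(\pi_vL,\,i_v\Omega)$ for $v\neq 0$, where $\pi_v:V\to V/\mathbb R v$ is the quotient map and $i_v\Omega=\Omega(v,\cdot)$ is regarded as a volume form on $V/\mathbb R v$. Let $\mathrm{svol}=\mathrm{vol}\times\mathrm{vol}^*$ be the symplectic volume on $V\times V^*$, where $\mathrm{vol}^*$ is the Lebesgue measure dual to $\mathrm{vol}$. For a unit ball $B$ and $n\geq 2$ put $$\mathcal V(B):=\frac{\omega_n^{\,n-1}}{\omega_{n-1}^{\,n}}\ \sup\bigl\{\mathrm{svol}(B\times \Pi L)\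 :\ L\in\mathcal K(V),\ V_1(L,B)=1\bigr\}.$$ A functional $F$ on unit balls (such as $\mathcal V$, or Busemann's $\mathcal V^b(B):=\omega_{\dim V}$) induces a $k$-density on every finite-dimensional real vector space $V$ with unit ball $B$: if $a=v_1\wedge\dots\wedge v_k\ne 0$ is a simple $k$-vector, $W=\langle a\rangle$ is the span of $v_1,\dots,v_k$, and $\mathrm{vol}_a$ is the Lebesgue measure on $W$ for which the parallelepiped spanned by $v_1,\dots,v_k$ has measure one, then $$\mu_k(a):=\frac{F(B\cap W)}{\mathrm{vol}_a(B\cap W)},\qquad \mu_k(0):=0\quad(k\ge1),$$ that is, $\mu_k(a)$ is the measure of this parallelepiped with respect to the Lebesgue measure on $W$ that gives $B\cap W$ the measure $F(B\cap W)$. **Corollary.** If $\dim V=2$, then $$\mathcal V(B)=\omega_2=\pi$$ for every unit ball $B\subset V$. Moreover, for every finite-dimensional real vector space $V$ and every unit ball $B\subset V$, the $2$-density induced by $\mathcal V$ coincides, on all simple $2$-vectors of $V$, with the $2$-density induced by Busemann's functional $\mathcal V^b$. -/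

import Mathlib

open scoped Pointwise

noncomputable section

namespace ConvexVolume

universe u

/-- The volume `ω_n` of the Euclidean unit ball in dimension `n`. -/
def omega (n : ℕ) : ℝ :=
  (MeasureTheory.volume (Metric.closedBall (0 : EuclideanSpace ℝ (Fin n)) 1)).toReal

/-- The Lebesgue measure on `V` normalised so that the parallelepiped spanned by the basis `b` has
measure one. Every Lebesgue measure on `V` is of this form for some basis `b`. -/
def vol {V : Type*} [AddCommGroup V] [Module ℝ V] {n : ℕ} (b : Module.Basis (Fin n) ℝ V)
    (S : Set V) : ℝ :=
  (MeasureTheory.volume (b.equivFun '' S)).toReal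

/-- The symplectic volume of a subset of `V × V*`: the product of the Lebesgue measure of a basis
of `V` and of the Lebesgue measure of the dual basis of `V*`. It does not depend on the basis. -/
def svol {V : Type*} [AddCommGroup V] [Module ℝ V] {n : ℕ} (b : Module.Basis (Fin n) ℝ V)
    (S : Set (V × Module.Dual ℝ V)) : ℝ :=
  (MeasureTheory.volume (Prod.map b.equivFun b.dualBasis.equivFun '' S)).toReal

/-- The mixed volume `V(K_1, …, K_n)` of compact convex sets in the `n`-dimensional space `V`,
by the polarization formula
`n! V(K_1, …, K_n) = ∑_{∅ ≠ S ⊆ {1, …, n}} (-1)^(n - |S|) vol (∑_{i ∈ S} K_i)`. -/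
def mixedVolume {V : Type*} [AddCommGroup V] [Module ℝ V] {n : ℕ} (b : Module.Basis (Fin n) ℝ V)
    (K : Fin n → Set V) : ℝ :=
  (1 / (n.factorial : ℝ)) *
    ∑ S ∈ (Finset.univ : Finset (Finset (Fin n))) with S.Nonempty,
      (-1 : ℝ) ^ (n - S.card) * vol b (∑ i ∈ S, K i)

/-- `V_i(K, L) = V(K, …, K, L, …, L)` with `n - i` copies of `K` and `i` copies of `L`. -/
def mixedVolumeIdx {V : Type*} [AddCommGroup V] [Module ℝ V] {n : ℕ}
    (b : Module.Basis (Fin n) ℝ V) (i : ℕ) (K L : Set V) : ℝ :=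
  mixedVolume b (fun j => if (j : ℕ) < n - i then K else L)

/-- The volume `vol (π_v K, i_v Ω)` of the image of `K` in the quotient `V / ℝ v`, for `v ≠ 0` and
the volume form `Ω` with density `vol b`. Here `c = (π w_1, …, π w_d)` is a basis of the quotient,
the Lebesgue measure `vol c` gives its parallelepiped measure one, and `i_v Ω` gives it the measure
`|Ω(v, w_1, …, w_d)|`, the volume of the parallelepiped spanned by `v, w_1, …, w_d`. -/
def projectionVolume {V : Type*} [AddCommGroup V] [Module ℝ V] [FiniteDimensional ℝ V] {n : ℕ}
    (b : Module.Basis (Fin n) ℝ V) (K : Set V) (v : V) : ℝ :=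
  let c := Module.finBasis ℝ (V ⧸ Submodule.span ℝ {v})
  let w := fun i => Function.surjInv (Submodule.mkQ_surjective (Submodule.span ℝ {v})) (c i)
  vol b (parallelepiped (Fin.cons v w : Fin _ → V)) *
    vol c (Submodule.mkQ (Submodule.span ℝ {v}) '' K)

/-- The projection body `Π K ⊆ V*`: the convex body with support function
`h(Π K, v) = vol (π_v K, i_v Ω)` for `v ≠ 0`. -/
def projectionBody {V : Type*} [AddCommGroup V] [Module ℝ V] [FiniteDimensional ℝ V] {n : ℕ}
    (b : Module.Basis (Fin n) ℝ V) (K : Set V) : Set (Module.Dual ℝ V) :=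
  {ξ | ∀ v : V, v ≠ 0 → ξ v ≤ projectionVolume b K v}

/-- The unit balls of norms on `V`: compact convex sets, symmetric about the origin, with
non-empty interior. -/
structure IsUnitBall {V : Type*} [AddCommGroup V] [Module ℝ V] [TopologicalSpace V]
    (B : Set V) : Prop where
  convex : Convex ℝ B
  isCompact : IsCompact B
  neg_mem : ∀ x ∈ B, -x ∈ B
  interior_nonempty : (interior B).Nonempty

/-- The functional
`𝒱(B) = ω_n^(n-1) / ω_(n-1)^n * sup {svol (B × Π L) | L ∈ 𝒦(V), V_1(L, B) = 1}`,
where `V_1` and `Π` are taken with respect to the Lebesgue measure `vol b`. -/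
def functional {V : Type*} [AddCommGroup V] [Module ℝ V] [FiniteDimensional ℝ V]
    [TopologicalSpace V] {n : ℕ} (b : Module.Basis (Fin n) ℝ V) (B : Set V) : ℝ :=
  omega n ^ (n - 1) / omega (n - 1) ^ n *
    sSup {s : ℝ | ∃ L : ConvexBody V, mixedVolumeIdx b 1 (L : Set V) B = 1 ∧
      s = svol b (B ×ˢ projectionBody b (L : Set V))}

/-- A real-valued functional on the subsets (in particular the unit balls) of all
finite-dimensional spaces, such as the associated affine invariant of a definition of volume. -/
abbrev AffineInvariant : Type (u + 1) :=
  ∀ (W : Type u) [AddCommGroup W] [Module ℝ W] [FiniteDimensional ℝ W] [TopologicalSpace W],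
    Set W → ℝ

/-- The functional `𝒱`, with some choice of a Lebesgue measure in each space. -/
def centroidInvariant : AffineInvariant.{u} :=
  fun W _ _ _ _ B => functional (Module.finBasis ℝ W) B

/-- The affine invariant `ω_n` of Busemann's definition of volume. -/
def busemannInvariant : AffineInvariant.{u} :=
  fun W _ _ _ _ _ => omega (Module.finrank ℝ W)

/-- The norm `μ_B` on `Λⁿ W`, `n = dim W`, of the definition of volume with associated affine
invariant `F`. The corresponding Lebesgue measure gives `B` the measure `F(B)`, so that it is
`F(B) / vol B` times the measure of the basis `b`, and `w_1 ∧ … ∧ w_n` has the norm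
`F(B) / vol B * |det (w_1, …, w_n)|`. -/
def topNorm (F : AffineInvariant.{u}) {W : Type u} [AddCommGroup W] [Module ℝ W]
    [FiniteDimensional ℝ W] [TopologicalSpace W] {n : ℕ} (b : Module.Basis (Fin n) ℝ W)
    (B : Set W) (a : ⋀[ℝ]^n W) : ℝ :=
  F W B / vol b B * |exteriorPower.alternatingMapLinearEquiv b.det a|

/-- The subspace `⟨a⟩ = {w | w ∧ a = 0}`: it is the span of `v_1, …, v_k` when
`a = v_1 ∧ … ∧ v_k ≠ 0`. -/
def multivectorSpan {V : Type*} [AddCommGroup V] [Module ℝ V] {k : ℕ} (a : ⋀[ℝ]^k V) :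
    Submodule ℝ V :=
  LinearMap.ker
    ((LinearMap.mulRight ℝ (a : ExteriorAlgebra ℝ V)).comp (ExteriorAlgebra.ι ℝ (M := V)))

/-- The cone `Λ^k_s V` of simple `k`-vectors `v_1 ∧ … ∧ v_k`. -/
def simpleVectors (k : ℕ) (V : Type*) [AddCommGroup V] [Module ℝ V] : Set (⋀[ℝ]^k V) :=
  Set.range (exteriorPower.ιMulti ℝ k)

open Classical in
/-- The `k`-volume density `μ_k(a) = μ_⟨a⟩(a)` induced on the space `V` with unit ball `B` by the
definition of volume with associated affine invariant `F`. The subspace `W = ⟨a⟩` has the unit ball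
`B ∩ W`, and `a` is considered as an element of `Λ^k W` through the injection `Λ^k W → Λ^k V`.
Only simple `a` matter; `0` has the density `0`. -/
def inducedDensity (F : AffineInvariant.{u}) {V : Type u} [AddCommGroup V] [Module ℝ V]
    [FiniteDimensional ℝ V] [TopologicalSpace V] (B : Set V) (k : ℕ) (a : ⋀[ℝ]^k V) : ℝ :=
  if h : a ≠ 0 ∧ Module.finrank ℝ (multivectorSpan a) = k then
    topNorm F (Module.finBasisOfFinrankEq ℝ (multivectorSpan a) h.2)
      ((multivectorSpan a).subtype ⁻¹' B)
      (Function.invFun (exteriorPower.map k (multivectorSpan a).subtype) a)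
  else 0

end ConvexVolume

end

/-! In a plane, `Ω` identifies `V*` with `V` up to a quarter turn, and the length of the projection
of `L` along `v` is the width of `L` in the turned direction. Hence `Π L` is the turned difference
body `L - L`, and `svol (B × Π L) = vol B * vol (L - L)` (`svol_prod_projectionBody`). As `B` is
symmetric, `V(L - L, B) = 2 V(L, B)`, so Minkowski's inequality gives `vol B * vol (L - L) ≤ 4 V(L,
B)² = 4`, with equality for a multiple of `B`. The supremum is therefore 4 and `𝒱(B) = (π / 2²) * 4
= π`. The two 2-densities agree because both functionals have the value `ω_2` on every planar
section of `B`.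

Two ingredients give the inequality `sqrt_le_mixed`. One is the planar Brunn–Minkowski inequality,
obtained from Bonnesen's inequality by slicing. The other is additivity of the mixed area with `B`,
which replaces the general theory of mixed volumes: it holds for segments by Cavalieri's principle,
and passes to linear images and Minkowski sums, hence to zonotopes. Every symmetric planar unit ball
lies between a zonotope and a slightly shrunken copy of it (`exists_mixedAdditive_approx`), so the
zonotope case suffices in the limit. -/

section

open MeasureTheory Set

/-! ### Brunn–Minkowski on the line -/

/-- The one-dimensional Brunn–Minkowski inequality for compact sets. -/
theorem IsCompact.volume_add_volume_le {C D : Set ℝ} (hC : IsCompact C) (hD : IsCompact D)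
    (hCn : C.Nonempty) (hDn : D.Nonempty) : volume C + volume D ≤ volume (C + D) := by
  have hs : sSup C ∈ C := hC.sSup_mem hCn
  have hi : sInf D ∈ D := hD.sInf_mem hDn
  -- The translates of `C` by `min D` and of `D` by `max C` lie in `C + D` and meet only at `max C +
  -- min D`, so their lengths add.
  have h1 : (fun x => sInf D + x) '' C ⊆ C + D := by
    rintro _ ⟨x, hx, rfl⟩
    exact ⟨x, hx, _, hi, add_comm _ _⟩
  have h2 : (fun x => sSup C + x) '' D ⊆ C + D := by
    rintro _ ⟨x, hx, rfl⟩
    exact ⟨_, hs, x, hx, rfl⟩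
  have h3 : (fun x => sInf D + x) '' C ∩ (fun x => sSup C + x) '' D ⊆ {sSup C + sInf D} := by
    rintro _ ⟨⟨x, hx, rfl⟩, ⟨y, hy, hxy⟩⟩
    have h4 := le_csSup hC.bddAbove hx
    have h5 := csInf_le hD.bddBelow hy
    simp only [mem_singleton_iff] at *
    linarith
  have hm : MeasurableSet ((fun x => sSup C + x) '' D) :=
    (hD.image (by fun_prop)).measurableSet
  calc volume C + volume D
      = volume ((fun x => sInf D + x) '' C) + volume ((fun x => sSup C + x) '' D) := by
        simp only [image_add_left, measure_preimage_add]
    _ = volume ((fun x => sInf D + x) '' C ∪ (fun x => sSup C + x) '' D) +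
          volume ((fun x => sInf D + x) '' C ∩ (fun x => sSup C + x) '' D) :=
        (measure_union_add_inter _ hm).symm
    _ = volume ((fun x => sInf D + x) '' C ∪ (fun x => sSup C + x) '' D) := by
        rw [measure_mono_null h3 (by simp), add_zero]
    _ ≤ volume (C + D) := measure_mono (union_subset h1 h2)

/-- The one-dimensional Brunn–Minkowski inequality for measurable sets of finite measure. -/
theorem MeasurableSet.volume_add_volume_le {I J : Set ℝ} (hI : MeasurableSet I)
    (hJ : MeasurableSet J) (hIn : I.Nonempty) (hJn : J.Nonempty) (hI' : volume I ≠ ⊤)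
    (hJ' : volume J ≠ ⊤) : volume I + volume J ≤ volume (I + J) := by
  refine ENNReal.le_of_forall_pos_le_add fun ε hε _ => ?_
  have hε' : (ε / 2 : NNReal) ≠ 0 := (half_pos hε).ne'
  obtain ⟨C, hCI, hC, hC'⟩ := hI.exists_isCompact_lt_add hI'
    (ENNReal.coe_ne_zero.2 hε')
  obtain ⟨D, hDJ, hD, hD'⟩ := hJ.exists_isCompact_lt_add hJ'
    (ENNReal.coe_ne_zero.2 hε')
  obtain ⟨x, hx⟩ := hIn
  obtain ⟨y, hy⟩ := hJn
  -- The inner approximations may be empty; inserting a point of each set keeps their sum non-empty.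
  have h := (hC.insert x).volume_add_volume_le (hD.insert y) (insert_nonempty _ _)
    (insert_nonempty _ _)
  have h1 : insert x C + insert y D ⊆ I + J :=
    add_subset_add (insert_subset hx hCI) (insert_subset hy hDJ)
  calc volume I + volume J
      ≤ (volume C + (ε / 2 : NNReal)) + (volume D + (ε / 2 : NNReal)) := add_le_add hC'.le hD'.le
    _ = volume C + volume D + ε := by
        rw [add_add_add_comm, ← ENNReal.coe_add, add_halves]
    _ ≤ volume (insert x C) + volume (insert y D) + ε := by
        gcongr <;> exact subset_insert _ _
    _ ≤ volume (I + J) + ε := by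
        gcongr
        exact h.trans (measure_mono h1)

/-! ### Bonnesen's inequality and planar Brunn–Minkowski by slicing -/

namespace Planar

/-- The length of the vertical slice of `K` over `x`. -/
noncomputable def sliceLength (K : Set (ℝ × ℝ)) (x : ℝ) : ℝ := volume.real (Prod.mk x ⁻¹' K)

theorem isCompact_slice {K : Set (ℝ × ℝ)} (hK : IsCompact K) (x : ℝ) :
    IsCompact (Prod.mk x ⁻¹' K) := by
  have : Topology.IsClosedEmbedding (Prod.mk x : ℝ → ℝ × ℝ) :=
    Topology.IsClosedEmbedding.of_continuous_injective_isClosedMap (by fun_prop)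
      (Prod.mk_right_injective x) (isClosedMap_prodMk_left x)
  exact this.isCompact_preimage hK

theorem measurable_sliceLength {K : Set (ℝ × ℝ)} (hK : IsCompact K) :
    Measurable (sliceLength K) :=
  (measurable_measure_prodMk_left hK.measurableSet).ennreal_toReal

theorem sliceLength_nonneg (K : Set (ℝ × ℝ)) (x : ℝ) : 0 ≤ sliceLength K x := measureReal_nonneg

theorem bddAbove_sliceLength {K : Set (ℝ × ℝ)} (hK : IsCompact K) :
    BddAbove (range (sliceLength K)) := by
  have hc : IsCompact (Prod.snd '' K) := hK.image continuous_snd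
  refine ⟨volume.real (Prod.snd '' K), ?_⟩
  rintro _ ⟨x, rfl⟩
  exact measureReal_mono (fun y hy => ⟨(x, y), hy, rfl⟩) hc.measure_lt_top.ne

theorem volume_eq_lintegral_sliceLength {K : Set (ℝ × ℝ)} (hK : IsCompact K) :
    volume K = ∫⁻ x, ENNReal.ofReal (sliceLength K x) := by
  rw [Measure.volume_eq_prod, Measure.prod_apply hK.measurableSet]
  refine lintegral_congr fun x => ?_
  rw [sliceLength, measureReal_def, ENNReal.ofReal_toReal (isCompact_slice hK x).measure_lt_top.ne]

/-- Layer-cake formula for the slice length, with levels measured as fractions of `F`. This lets the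
levels of two sets with different maximal slices be compared. -/
theorem volume_eq_lintegral_level {K : Set (ℝ × ℝ)} (hK : IsCompact K) {F : ℝ} (hF : 0 < F) :
    volume K = ENNReal.ofReal F * ∫⁻ s in Ioi (0 : ℝ), volume {x | s * F < sliceLength K x} := by
  have h1 := lintegral_eq_lintegral_meas_lt volume (f := fun x => sliceLength K x / F)
    (Filter.Eventually.of_forall fun x => div_nonneg (sliceLength_nonneg K x) hF.le)
    ((measurable_sliceLength hK).div_const F).aemeasurable
  simp only [lt_div_iff₀ hF] at h1
  rw [← h1, volume_eq_lintegral_sliceLength hK, ← lintegral_const_mul']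
  · refine lintegral_congr fun x => ?_
    rw [← ENNReal.ofReal_mul hF.le, mul_div_cancel₀ _ hF.ne']
  · exact ENNReal.ofReal_ne_top

theorem level_eq_Ioo {K : Set (ℝ × ℝ)} {F : ℝ} (hF : 0 < F)
    (h : ∀ x, sliceLength K x ≤ F) :
    ∫⁻ s in Ioi (0 : ℝ), volume {x | s * F < sliceLength K x} =
      ∫⁻ s in Ioo (0 : ℝ) 1, volume {x | s * F < sliceLength K x} := by
  rw [← Ioo_union_Ici_eq_Ioi (zero_lt_one (α := ℝ)), lintegral_union measurableSet_Ici]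
  · rw [setLIntegral_congr_fun (s := Ici 1) (g := fun _ => 0) measurableSet_Ici]
    · simp
    · intro s hs
      have : {x | s * F < sliceLength K x} = ∅ := by
        ext x
        simp only [mem_ofPred_eq, mem_empty_iff_false, iff_false, not_lt]
        have : 1 ≤ s := hs
        nlinarith [h x]
      simp [this]
  · exact (Iio_disjoint_Ici le_rfl).mono_left Ioo_subset_Iio_self

theorem sliceLength_pos_iff_nonempty {K : Set (ℝ × ℝ)} {x : ℝ} (h : 0 < sliceLength K x) :
    (Prod.mk x ⁻¹' K).Nonempty := by
  by_contra h'
  rw [not_nonempty_iff_eq_empty] at h'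
  simp [sliceLength, h'] at h

theorem sliceLength_add_le {K L : Set (ℝ × ℝ)} (hK : IsCompact K) (hL : IsCompact L) {x y : ℝ}
    (hx : 0 < sliceLength K x) (hy : 0 < sliceLength L y) :
    sliceLength K x + sliceLength L y ≤ sliceLength (K + L) (x + y) := by
  have h := (isCompact_slice hK x).volume_add_volume_le (isCompact_slice hL y)
    (sliceLength_pos_iff_nonempty hx) (sliceLength_pos_iff_nonempty hy)
  have h2 : Prod.mk x ⁻¹' K + Prod.mk y ⁻¹' L ⊆ Prod.mk (x + y) ⁻¹' (K + L) := by
    rintro _ ⟨a, ha, b, hb, rfl⟩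
    exact ⟨_, ha, _, hb, rfl⟩
  have h3 := h.trans (measure_mono h2)
  rw [sliceLength, sliceLength, sliceLength, measureReal_def, measureReal_def, measureReal_def,
    ← ENNReal.toReal_add (isCompact_slice hK x).measure_lt_top.ne
      (isCompact_slice hL y).measure_lt_top.ne]
  exact ENNReal.toReal_mono (isCompact_slice (hK.add hL) _).measure_lt_top.ne h3

theorem exists_sliceLength_sup {K : Set (ℝ × ℝ)} (hK : IsCompact K) (h : 0 < volume.real K) :
    ∃ F : ℝ, 0 < F ∧ (∀ x, sliceLength K x ≤ F) ∧ ∀ s < 1, ∃ x, s * F < sliceLength K x := by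
  have hle : ∀ x, sliceLength K x ≤ ⨆ x, sliceLength K x := le_ciSup (bddAbove_sliceLength hK)
  have hpos : 0 < ⨆ x, sliceLength K x := by
    by_contra! hneg
    have h0 : ∀ x, sliceLength K x = 0 := fun x =>
      le_antisymm ((hle x).trans hneg) (sliceLength_nonneg K x)
    rw [measureReal_def, volume_eq_lintegral_sliceLength hK] at h
    simp [h0] at h
  refine ⟨_, hpos, hle, fun s hs => exists_lt_of_lt_ciSup ?_⟩
  nlinarith

theorem volume_level_ne_top {K : Set (ℝ × ℝ)} (hK : IsCompact K) {s F : ℝ} (h : 0 ≤ s * F) :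
    volume {x | s * F < sliceLength K x} ≠ ⊤ := by
  refine ne_top_of_le_ne_top (hK.image continuous_fst).measure_lt_top.ne
    (measure_mono fun x hx => ?_)
  obtain ⟨y, hy⟩ := sliceLength_pos_iff_nonempty (lt_of_le_of_lt h hx)
  exact ⟨_, hy, rfl⟩

/-- Bonnesen's sharpening of the planar Brunn–Minkowski inequality. -/
theorem bonnesen_inequality {K L : Set (ℝ × ℝ)} (hK : IsCompact K)
    (hL : IsCompact L) (hK0 : 0 < volume.real K) (hL0 : 0 < volume.real L) :
    ∃ F G : ℝ, 0 < F ∧ 0 < G ∧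
      (F + G) * (volume.real K / F + volume.real L / G) ≤ volume.real (K + L) := by
  obtain ⟨F, hF, hFle, hFlt⟩ := exists_sliceLength_sup hK hK0
  obtain ⟨G, hG, hGle, hGlt⟩ := exists_sliceLength_sup hL hL0
  refine ⟨F, G, hF, hG, ?_⟩
  have eK := volume_eq_lintegral_level hK hF
  have eL := volume_eq_lintegral_level hL hG
  rw [level_eq_Ioo hF hFle] at eK
  rw [level_eq_Ioo hG hGle] at eL
  have eKL := volume_eq_lintegral_level (hK.add hL) (add_pos hF hG)
  set a := ∫⁻ s in Ioo (0 : ℝ) 1, volume {x | s * F < sliceLength K x} with ha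
  set b := ∫⁻ s in Ioo (0 : ℝ) 1, volume {x | s * G < sliceLength L x} with hb
  -- The levels are not cut off at 1 here: a slice of `K + L` may be longer than `F + G`.
  set c := ∫⁻ s in Ioi (0 : ℝ), volume {x | s * (F + G) < sliceLength (K + L) x} with hc
  have habc : a + b ≤ c := by
    have hm : Measurable fun s : ℝ => volume {x | s * G < sliceLength L x} := by
      refine Antitone.measurable fun s t hst => measure_mono fun x hx => ?_
      have : t * G < sliceLength L x := hx
      show s * G < sliceLength L x
      nlinarith
    rw [ha, hb, ← lintegral_add_right _ hm]
    -- For each fraction `s < 1` both superlevel sets are non-empty, and their sum lies in the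
    -- superlevel set of `K + L`, so Brunn–Minkowski on the line applies level by level.
    refine le_trans (setLIntegral_mono' measurableSet_Ioo fun s hs => ?_)
      (lintegral_mono_set Ioo_subset_Ioi_self)
    have h1 : {x | s * F < sliceLength K x} + {x | s * G < sliceLength L x} ⊆
        {x | s * (F + G) < sliceLength (K + L) x} := by
      rintro _ ⟨x, hx, y, hy, rfl⟩
      have hx' : s * F < sliceLength K x := hx
      have hy' : s * G < sliceLength L y := hy
      have := sliceLength_add_le hK hL ((mul_pos hs.1 hF).trans hx) ((mul_pos hs.1 hG).trans hy)
      show s * (F + G) < sliceLength (K + L) (x + y)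
      linarith
    refine le_trans ?_ (measure_mono h1)
    exact MeasurableSet.volume_add_volume_le
      (measurableSet_lt measurable_const (measurable_sliceLength hK))
      (measurableSet_lt measurable_const (measurable_sliceLength hL))
      (hFlt s hs.2) (hGlt s hs.2) (volume_level_ne_top hK (mul_pos hs.1 hF).le)
      (volume_level_ne_top hL (mul_pos hs.1 hG).le)
  have hctop : c ≠ ⊤ := by
    intro h
    rw [h, ENNReal.mul_top (by simpa using add_pos hF hG)] at eKL
    exact (hK.add hL).measure_lt_top.ne eKL
  have hatop : a ≠ ⊤ := ne_top_of_le_ne_top hctop (le_self_add.trans habc)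
  have hbtop : b ≠ ⊤ := ne_top_of_le_ne_top hctop (le_add_self.trans habc)
  have h := ENNReal.toReal_mono hctop habc
  rw [ENNReal.toReal_add hatop hbtop] at h
  rw [measureReal_def, measureReal_def, measureReal_def, eK, eL, eKL, ENNReal.toReal_mul,
    ENNReal.toReal_mul, ENNReal.toReal_mul, ENNReal.toReal_ofReal hF.le,
    ENNReal.toReal_ofReal hG.le, ENNReal.toReal_ofReal (add_pos hF hG).le,
    mul_div_cancel_left₀ _ hF.ne', mul_div_cancel_left₀ _ hG.ne']
  exact mul_le_mul_of_nonneg_left h (add_pos hF hG).le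

/-- The planar Brunn–Minkowski inequality for compact sets. -/
theorem brunn_minkowski {K L : Set (ℝ × ℝ)} (hK : IsCompact K) (hL : IsCompact L)
    (hKn : K.Nonempty) (hLn : L.Nonempty) :
    volume.real K + volume.real L + 2 * √(volume.real K * volume.real L) ≤
      volume.real (K + L) := by
  have htop : volume (K + L) ≠ ⊤ := (hK.add hL).measure_lt_top.ne
  -- Bonnesen's inequality needs positive areas. If one set is null, the sum still contains a
  -- translate of the other.
  rcases eq_or_lt_of_le (measureReal_nonneg (μ := volume) (s := K)) with hK0 | hK0
  · obtain ⟨x, hx⟩ := hKn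
    have : (fun y => x + y) '' L ⊆ K + L := by
      rintro _ ⟨y, hy, rfl⟩
      exact ⟨x, hx, y, hy, rfl⟩
    have h := measureReal_mono this htop
    rw [image_add_left, measureReal_def, measure_preimage_add, ← measureReal_def] at h
    simpa [← hK0] using h
  rcases eq_or_lt_of_le (measureReal_nonneg (μ := volume) (s := L)) with hL0 | hL0
  · obtain ⟨x, hx⟩ := hLn
    have : (fun y => x + y) '' K ⊆ K + L := by
      rintro _ ⟨y, hy, rfl⟩
      exact ⟨y, hy, x, hx, add_comm _ _⟩
    have h := measureReal_mono this htop
    rw [image_add_left, measureReal_def, measure_preimage_add, ← measureReal_def] at h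
    simpa [← hL0] using h
  obtain ⟨F, G, hF, hG, h⟩ := bonnesen_inequality hK hL hK0 hL0
  refine le_trans ?_ h
  set a := volume.real K
  set b := volume.real L
  have h1 : (F + G) * (a / F + b / G) = a + b + (G * (a / F) + F * (b / G)) := by
    field_simp
    ring
  -- The two cross terms have product `a * b` whatever `F` and `G` are, so the arithmetic-geometric
  -- mean inequality bounds their sum.
  have h2 : a * b = (G * (a / F)) * (F * (b / G)) := by
    field_simp
  have hp : 0 ≤ G * (a / F) := by positivity
  have hq : 0 ≤ F * (b / G) := by positivity
  rw [h1, h2, Real.sqrt_mul hp]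
  nlinarith [sq_nonneg (√(G * (a / F)) - √(F * (b / G))), Real.sq_sqrt hp, Real.sq_sqrt hq]

/-! ### Convex bodies and sums with a segment -/

/-- Non-empty compact convex sets. -/
structure IsBody {E : Type*} [AddCommGroup E] [Module ℝ E] [TopologicalSpace E] (K : Set E) :
    Prop where
  nonempty : K.Nonempty
  isCompact : IsCompact K
  convex : Convex ℝ K

namespace IsBody

variable {E F : Type*} [AddCommGroup E] [Module ℝ E] [TopologicalSpace E]
  [AddCommGroup F] [Module ℝ F] [TopologicalSpace F] {K L : Set E}

theorem add [IsTopologicalAddGroup E] (hK : IsBody K) (hL : IsBody L) : IsBody (K + L) :=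
  ⟨hK.nonempty.add hL.nonempty, hK.isCompact.add hL.isCompact, hK.convex.add hL.convex⟩

theorem neg [IsTopologicalAddGroup E] (hK : IsBody K) : IsBody (-K) :=
  ⟨hK.nonempty.neg, hK.isCompact.neg, hK.convex.neg⟩

theorem smul [ContinuousSMul ℝ E] (c : ℝ) (hK : IsBody K) : IsBody (c • K) :=
  ⟨hK.nonempty.smul_set, hK.isCompact.image (continuous_const_smul c), hK.convex.smul c⟩

theorem image (T : E →ₗ[ℝ] F) (hT : Continuous T) (hK : IsBody K) : IsBody (T '' K) :=
  ⟨hK.nonempty.image _, hK.isCompact.image hT, hK.convex.linear_image T⟩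

theorem singleton (x : E) : IsBody {x} := ⟨singleton_nonempty x, isCompact_singleton,
  convex_singleton x⟩

end IsBody

theorem IsBody.exists_eq_Icc {I : Set ℝ} (hI : IsBody I) : ∃ p q, p ≤ q ∧ I = Icc p q := by
  have h := eq_Icc_of_connected_compact ⟨hI.nonempty, hI.convex.isPreconnected⟩ hI.isCompact
  refine ⟨_, _, ?_, h⟩
  rw [← nonempty_Icc, ← h]
  exact hI.nonempty

theorem volume_real_add {I J : Set ℝ} (hI : IsBody I) (hJ : IsBody J) :
    volume.real (I + J) = volume.real I + volume.real J := by
  obtain ⟨p, q, hpq, rfl⟩ := hI.exists_eq_Icc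
  obtain ⟨r, s, hrs, rfl⟩ := hJ.exists_eq_Icc
  rw [Icc_add_Icc hpq hrs, Real.volume_real_Icc_of_le hpq, Real.volume_real_Icc_of_le hrs,
    Real.volume_real_Icc_of_le (add_le_add hpq hrs)]
  ring

/-- The segment from `-g` to `g`. -/
def symmSegment {E : Type*} [AddCommGroup E] [Module ℝ E] (g : E) : Set E :=
  (fun t : ℝ => t • g) '' Icc (-1) 1

theorem isBody_symmSegment {E : Type*} [AddCommGroup E] [Module ℝ E] [TopologicalSpace E]
    [ContinuousSMul ℝ E] (g : E) : IsBody (symmSegment g) := by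
  have : IsBody (Icc (-1 : ℝ) 1) := ⟨nonempty_Icc.2 (by norm_num), isCompact_Icc, convex_Icc _ _⟩
  exact this.image (LinearMap.toSpanSingleton ℝ E g) (continuous_id.smul continuous_const)

theorem neg_symmSegment {E : Type*} [AddCommGroup E] [Module ℝ E] (g : E) :
    -symmSegment g = symmSegment g := by
  ext x
  simp only [symmSegment, Set.mem_neg, mem_image, mem_Icc]
  constructor
  · rintro ⟨t, ht, h⟩
    exact ⟨-t, ⟨by linarith, by linarith⟩, by rw [neg_smul, h, neg_neg]⟩
  · rintro ⟨t, ht, h⟩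
    exact ⟨-t, ⟨by linarith, by linarith⟩, by rw [neg_smul, h]⟩

theorem mem_symmSegment_vertical {p : ℝ × ℝ} :
    p ∈ symmSegment ((0, 1) : ℝ × ℝ) ↔ p.1 = 0 ∧ p.2 ∈ Icc (-1 : ℝ) 1 := by
  simp only [symmSegment, mem_image, Prod.smul_mk, smul_eq_mul, mul_zero, mul_one]
  constructor
  · rintro ⟨t, ht, rfl⟩
    exact ⟨rfl, ht⟩
  · rintro ⟨h1, h2⟩
    exact ⟨p.2, h2, Prod.ext h1.symm rfl⟩

theorem slice_add_vertical (K : Set (ℝ × ℝ)) (x : ℝ) :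
    Prod.mk x ⁻¹' (K + symmSegment (0, 1)) = Prod.mk x ⁻¹' K + Icc (-1 : ℝ) 1 := by
  ext y
  simp only [mem_preimage, Set.mem_add, mem_symmSegment_vertical]
  constructor
  · rintro ⟨⟨a, b⟩, hab, ⟨c, d⟩, ⟨hc, hd⟩, h⟩
    simp only [Prod.mk_add_mk, Prod.mk.injEq] at h hc
    obtain ⟨rfl, rfl⟩ := h
    subst hc
    exact ⟨b, by simpa using hab, d, hd, rfl⟩
  · rintro ⟨b, hb, d, hd, rfl⟩
    exact ⟨(x, b), hb, (0, d), ⟨rfl, hd⟩, by simp⟩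

theorem IsBody.slice {K : Set (ℝ × ℝ)} (hK : IsBody K) {x : ℝ} (h : (Prod.mk x ⁻¹' K).Nonempty) :
    IsBody (Prod.mk x ⁻¹' K) := by
  refine ⟨h, isCompact_slice hK.isCompact x, fun y hy z hz a b ha hb hab => ?_⟩
  have := hK.convex hy hz ha hb hab
  simpa [← add_mul, hab] using this

/-- Cavalieri's principle: by convexity each non-empty vertical slice is an interval, and adding the
segment lengthens it by 2. -/
theorem volume_add_vertical {K : Set (ℝ × ℝ)} (hK : IsBody K) :
    volume.real (K + symmSegment (0, 1)) = volume.real K + 2 * volume.real (Prod.fst '' K) := by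
  have hS := isBody_symmSegment ((0, 1) : ℝ × ℝ)
  have hfst : IsCompact (Prod.fst '' K) := hK.isCompact.image continuous_fst
  have key : volume (K + symmSegment (0, 1)) = volume K + 2 * volume (Prod.fst '' K) := by
    rw [Measure.volume_eq_prod, Measure.prod_apply (hK.add hS).isCompact.measurableSet,
      Measure.prod_apply hK.isCompact.measurableSet]
    have : 2 * volume (Prod.fst '' K) = ∫⁻ x, (Prod.fst '' K).indicator (fun _ => 2) x := by
      rw [lintegral_indicator hfst.measurableSet, setLIntegral_const]
    rw [this, ← lintegral_add_right _ (measurable_const.indicator hfst.measurableSet)]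
    refine lintegral_congr fun x => ?_
    rw [slice_add_vertical]
    by_cases hx : (Prod.mk x ⁻¹' K).Nonempty
    · have hx' : x ∈ Prod.fst '' K := by
        obtain ⟨y, hy⟩ := hx
        exact ⟨_, hy, rfl⟩
      obtain ⟨p, q, hpq, h⟩ := (hK.slice hx).exists_eq_Icc
      rw [indicator_of_mem hx', h, Icc_add_Icc hpq (by norm_num), Real.volume_Icc,
        Real.volume_Icc, show q + 1 - (p + -1) = (q - p) + 2 by ring,
        ENNReal.ofReal_add (by linarith) (by norm_num)]
      simp
    · have hx' : x ∉ Prod.fst '' K := by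
        rintro ⟨⟨a, y⟩, hy, rfl⟩
        exact hx ⟨y, hy⟩
      rw [indicator_of_notMem hx', not_nonempty_iff_eq_empty.1 hx]
      simp
  rw [measureReal_def, key, ENNReal.toReal_add hK.isCompact.measure_lt_top.ne
    (ENNReal.mul_ne_top (by simp) hfst.measure_lt_top.ne), ENNReal.toReal_mul]
  simp [measureReal_def]

/-! ### Additivity of the mixed area with a zonotope -/

/-- The mixed area with `B` is additive in its other argument. -/
def MixedAdditive (B : Set (ℝ × ℝ)) : Prop :=
  ∀ K L : Set (ℝ × ℝ), IsBody K → IsBody L →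
    volume.real (K + L + B) + volume.real K + volume.real L + volume.real B =
      volume.real (K + L) + volume.real (K + B) + volume.real (L + B)

theorem mixedAdditive_zero : MixedAdditive 0 := by
  intro K L _ _
  simp only [add_zero]
  have : volume.real (0 : Set (ℝ × ℝ)) = 0 := by
    rw [measureReal_def, ← singleton_zero]
    simp
  linarith

/-- The area gained is twice the length of the shadow on the first axis, and lengths of intervals
add under Minkowski sums. -/
theorem mixedAdditive_vertical : MixedAdditive (symmSegment (0, 1)) := by
  intro K L hK hL
  have h0 : volume.real (symmSegment ((0, 1) : ℝ × ℝ)) = 0 := by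
    have h := volume_add_vertical (IsBody.singleton (0 : ℝ × ℝ))
    have h1 : volume.real {(0 : ℝ × ℝ)} = 0 := by rw [measureReal_def, measure_singleton]; rfl
    have h2 : volume.real {(0 : ℝ × ℝ).1} = 0 := by rw [measureReal_def, measure_singleton]; rfl
    rwa [Set.image_singleton, h1, h2, singleton_zero, zero_add, mul_zero, zero_add] at h
  have h1 : Prod.fst '' (K + L) = Prod.fst '' K + Prod.fst '' L :=
    Set.image_add (LinearMap.fst ℝ ℝ ℝ)
  rw [volume_add_vertical hK, volume_add_vertical hL, volume_add_vertical (hK.add hL), h0, h1,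
    volume_real_add (I := Prod.fst '' K) (J := Prod.fst '' L)
      (hK.image (LinearMap.fst ℝ ℝ ℝ) continuous_fst)
      (hL.image (LinearMap.fst ℝ ℝ ℝ) continuous_fst)]
  ring

theorem volume_real_image (T : (ℝ × ℝ) →ₗ[ℝ] (ℝ × ℝ)) (S : Set (ℝ × ℝ)) :
    volume.real (T '' S) = |LinearMap.det T| * volume.real S := by
  rw [measureReal_def, Measure.addHaar_image_linearMap, ENNReal.toReal_mul,
    ENNReal.toReal_ofReal (abs_nonneg _), measureReal_def]

theorem MixedAdditive.image {B : Set (ℝ × ℝ)} (hB : MixedAdditive B)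
    (T : (ℝ × ℝ) ≃ₗ[ℝ] (ℝ × ℝ)) : MixedAdditive (T '' B) := by
  have hc : ∀ S : (ℝ × ℝ) →ₗ[ℝ] (ℝ × ℝ), Continuous S :=
    fun S => S.continuous_of_finiteDimensional
  have hT : ∀ K, IsBody K → ∃ K', IsBody K' ∧ (T : (ℝ × ℝ) →ₗ[ℝ] (ℝ × ℝ)) '' K' = K :=
    fun K hK => ⟨_, hK.image _ (hc (T.symm : (ℝ × ℝ) →ₗ[ℝ] (ℝ × ℝ))), by rw [image_image]; simp⟩
  intro K L hK hL
  obtain ⟨K, hK', rfl⟩ := hT K hK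
  obtain ⟨L, hL', rfl⟩ := hT L hL
  rw [show T '' B = (T : (ℝ × ℝ) →ₗ[ℝ] (ℝ × ℝ)) '' B from rfl]
  simp only [← Set.image_add, volume_real_image (T : (ℝ × ℝ) →ₗ[ℝ] (ℝ × ℝ)), ← mul_add]
  rw [hB K L hK' hL']

/-- The orientation preserving similarity of the plane that maps `(0, 1)` to `g`. -/
noncomputable def similarityEquiv {g : ℝ × ℝ} (hg : g ≠ 0) : (ℝ × ℝ) ≃ₗ[ℝ] (ℝ × ℝ) where
  toFun p := (p.1 * g.2 + p.2 * g.1, -p.1 * g.1 + p.2 * g.2)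
  invFun p := ((p.1 * g.2 - p.2 * g.1) / (g.1 ^ 2 + g.2 ^ 2),
    (p.1 * g.1 + p.2 * g.2) / (g.1 ^ 2 + g.2 ^ 2))
  map_add' p q := by ext <;> simp <;> ring
  map_smul' c p := by ext <;> simp <;> ring
  left_inv p := by
    have : g.1 ^ 2 + g.2 ^ 2 ≠ 0 := fun h => hg (Prod.ext (by simp; nlinarith) (by simp; nlinarith))
    ext <;> simp only <;> field_simp <;> ring
  right_inv p := by
    have : g.1 ^ 2 + g.2 ^ 2 ≠ 0 := fun h => hg (Prod.ext (by simp; nlinarith) (by simp; nlinarith))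
    ext <;> simp only <;> field_simp <;> ring

theorem mixedAdditive_symmSegment (g : ℝ × ℝ) : MixedAdditive (symmSegment g) := by
  rcases eq_or_ne g 0 with rfl | hg
  · have : symmSegment (0 : ℝ × ℝ) = 0 := by
      simp only [symmSegment, smul_zero]
      exact (nonempty_Icc.2 (by norm_num)).image_const _
    rw [this]
    exact mixedAdditive_zero
  · convert mixedAdditive_vertical.image (similarityEquiv hg)
    rw [symmSegment, symmSegment, image_image]
    refine image_congr fun t _ => ?_
    ext <;> simp [similarityEquiv]

/-- Add `B` and `C` one after the other: additivity for `C` is applied to the pairs formed from `K`,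
`L`, `K + L` and `B`, which is why `B` has to be a body. -/
theorem MixedAdditive.add {B C : Set (ℝ × ℝ)} (hB : MixedAdditive B) (hC : MixedAdditive C)
    (hB' : IsBody B) : MixedAdditive (B + C) := by
  intro K L hK hL
  have h1 := hC (K + L) B (hK.add hL) hB'
  have h2 := hC K B hK hB'
  have h3 := hC L B hL hB'
  have h4 := hC K L hK hL
  have h5 := hB K L hK hL
  simp only [← add_assoc] at *
  linarith

/-- The sum of the segments from `-g i` to `g i`, `i ∈ s`. -/
def zonotope {ι E : Type*} [AddCommGroup E] [Module ℝ E] (s : Finset ι) (g : ι → E) : Set E :=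
  ∑ i ∈ s, symmSegment (g i)

theorem isBody_zonotope {ι E : Type*} [AddCommGroup E] [Module ℝ E] [TopologicalSpace E]
    [IsTopologicalAddGroup E] [ContinuousSMul ℝ E] (s : Finset ι) (g : ι → E) :
    IsBody (zonotope s g) :=
  Finset.sum_induction _ IsBody (fun _ _ h h' => h.add h') (IsBody.singleton 0)
    fun _ _ => isBody_symmSegment _

theorem neg_zonotope {ι E : Type*} [AddCommGroup E] [Module ℝ E] (s : Finset ι) (g : ι → E) :
    -zonotope s g = zonotope s g :=
  Finset.sum_induction _ (fun K : Set E => -K = K)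
    (fun K L h h' => by rw [neg_add, h, h']) (by simp) fun _ _ => neg_symmSegment _

theorem mixedAdditive_zonotope {ι : Type*} (s : Finset ι) (g : ι → ℝ × ℝ) :
    MixedAdditive (zonotope s g) :=
  (Finset.sum_induction (fun i => symmSegment (g i)) (fun K => IsBody K ∧ MixedAdditive K)
    (fun _ _ h h' => ⟨h.1.add h'.1, h.2.add h'.2 h.1⟩)
    ⟨IsBody.singleton 0, mixedAdditive_zero⟩
    fun _ _ => ⟨isBody_symmSegment _, mixedAdditive_symmSegment _⟩).2

theorem le_sum_of_mem_zonotope {ι E : Type*} [AddCommGroup E] [Module ℝ E] {s : Finset ι}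
    {g : ι → E} {x : E} (hx : x ∈ zonotope s g) (f : E →ₗ[ℝ] ℝ) : f x ≤ ∑ i ∈ s, |f (g i)| := by
  obtain ⟨y, hy, rfl⟩ := (Set.mem_finsetSum _ _ _).1 hx
  rw [map_sum]
  refine Finset.sum_le_sum fun i hi => ?_
  obtain ⟨t, ht, h⟩ := hy hi
  rw [← h, map_smul, smul_eq_mul]
  calc t * f (g i) ≤ |t * f (g i)| := le_abs_self _
    _ = |t| * |f (g i)| := abs_mul _ _
    _ ≤ 1 * |f (g i)| := by gcongr; exact abs_le.2 ht
    _ = _ := one_mul _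

theorem exists_mem_zonotope {ι E : Type*} [AddCommGroup E] [Module ℝ E] (s : Finset ι)
    (g : ι → E) (f : E →ₗ[ℝ] ℝ) : ∃ x ∈ zonotope s g, f x = ∑ i ∈ s, |f (g i)| := by
  -- On each segment the form is maximal at the endpoint given by the sign of `f (g i)`.
  refine ⟨∑ i ∈ s, (SignType.sign (f (g i)) : ℝ) • g i, ?_, ?_⟩
  · refine (Set.mem_finsetSum _ _ _).2 ⟨fun i => (SignType.sign (f (g i)) : ℝ) • g i,
      fun {i} _ => ⟨_, ?_, rfl⟩, rfl⟩
    rcases SignType.sign (f (g i)) with _ | _ | _ <;> simp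
  · simp [sign_mul_self]

theorem volume_real_neg (K : Set (ℝ × ℝ)) : volume.real (-K) = volume.real K := by
  rw [measureReal_def, Measure.measure_neg, measureReal_def]

/-- Minkowski's inequality for the mixed area of the difference body `K - K` and a
symmetric zonotope. -/
theorem sqrt_le_mixed_of_mixedAdditive {K Z : Set (ℝ × ℝ)} (hK : IsBody K) (hZ : IsBody Z)
    (hneg : -Z = Z) (hadd : MixedAdditive Z) :
    √(volume.real (K + -K) * volume.real Z) ≤
      volume.real (K + Z) - volume.real K - volume.real Z := by
  -- Since `-K + Z = -(K + Z)`, additivity gives `V(K - K, Z) = 2 V(K, Z)`; Brunn–Minkowski for `K -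
  -- K` and `Z` then finishes.
  have h1 := hadd K (-K) hK hK.neg
  have h2 : -K + Z = -(K + Z) := by rw [neg_add, hneg]
  rw [h2, volume_real_neg, volume_real_neg] at h1
  have h3 := brunn_minkowski (hK.add hK.neg).isCompact hZ.isCompact (hK.add hK.neg).nonempty
    hZ.nonempty
  linarith

/-! ### Support functions in the plane -/

/-- The linear form `x ↦ u.1 * x.1 + u.2 * x.2`. -/
def dot (u : ℝ × ℝ) : (ℝ × ℝ) →ₗ[ℝ] ℝ := u.1 • LinearMap.fst ℝ ℝ ℝ + u.2 • LinearMap.snd ℝ ℝ ℝ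

theorem dot_apply (u x : ℝ × ℝ) : dot u x = u.1 * x.1 + u.2 * x.2 := rfl

theorem dot_add_left (u v x : ℝ × ℝ) : dot (u + v) x = dot u x + dot v x := by
  simp only [dot_apply, Prod.fst_add, Prod.snd_add]; ring

theorem dot_smul_left (c : ℝ) (u x : ℝ × ℝ) : dot (c • u) x = c * dot u x := by
  simp only [dot_apply, Prod.smul_fst, Prod.smul_snd, smul_eq_mul]; ring

theorem eq_dot (f : (ℝ × ℝ) →ₗ[ℝ] ℝ) : f = dot (f (1, 0), f (0, 1)) := by
  ext <;> simp [dot_apply]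

theorem continuous_dot (u : ℝ × ℝ) : Continuous (dot u) :=
  (dot u).continuous_of_finiteDimensional

/-- The support function of a set in the plane. -/
noncomputable def support (B : Set (ℝ × ℝ)) (u : ℝ × ℝ) : ℝ := sSup (dot u '' B)

section support

variable {B : Set (ℝ × ℝ)}

theorem le_support (hB : IsBody B) (u : ℝ × ℝ) {x : ℝ × ℝ} (hx : x ∈ B) : dot u x ≤ support B u :=
  le_csSup (hB.isCompact.image (continuous_dot u)).bddAbove ⟨x, hx, rfl⟩

theorem exists_support (hB : IsBody B) (u : ℝ × ℝ) : ∃ x ∈ B, dot u x = support B u :=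
  (hB.isCompact.image (continuous_dot u)).sSup_mem (hB.nonempty.image _)

theorem support_add_le (hB : IsBody B) (u v : ℝ × ℝ) :
    support B (u + v) ≤ support B u + support B v := by
  obtain ⟨x, hx, h⟩ := exists_support hB (u + v)
  rw [← h, dot_add_left]
  exact add_le_add (le_support hB u hx) (le_support hB v hx)

theorem support_smul (hB : IsBody B) {c : ℝ} (hc : 0 ≤ c) (u : ℝ × ℝ) :
    support B (c • u) = c * support B u := by
  obtain ⟨x, hx, h⟩ := exists_support hB (c • u)
  obtain ⟨y, hy, h'⟩ := exists_support hB u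
  apply le_antisymm
  · rw [← h, dot_smul_left]
    exact mul_le_mul_of_nonneg_left (le_support hB u hx) hc
  · rw [← h', ← dot_smul_left]
    exact le_support hB _ hy

theorem support_neg (hB : IsBody B) (hneg : -B = B) (u : ℝ × ℝ) :
    support B (-u) = support B u := by
  have key : ∀ u, support B (-u) ≤ support B u := fun u => by
    obtain ⟨x, hx, h⟩ := exists_support hB (-u)
    rw [← hneg] at hx
    have := le_support hB u hx
    rw [← h]
    simp only [dot_apply, Prod.fst_neg, Prod.snd_neg] at *
    linarith
  exact le_antisymm (key u) (by simpa using key (-u))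

theorem support_le_mul (hB : IsBody B) {R : ℝ} (hR : ∀ x ∈ B, ‖x‖ ≤ R) (u : ℝ × ℝ) :
    support B u ≤ R * (|u.1| + |u.2|) := by
  obtain ⟨x, hx, h⟩ := exists_support hB u
  have h1 : |x.1| ≤ R := (norm_fst_le x).trans (hR x hx)
  have h2 : |x.2| ≤ R := (norm_snd_le x).trans (hR x hx)
  rw [← h, dot_apply]
  calc u.1 * x.1 + u.2 * x.2 ≤ |u.1| * |x.1| + |u.2| * |x.2| := by
        rw [← abs_mul, ← abs_mul]
        exact add_le_add (le_abs_self _) (le_abs_self _)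
    _ ≤ |u.1| * R + |u.2| * R := by gcongr
    _ = _ := by ring

/-- A body contains every set on which all linear forms are bounded by its support function. -/
theorem subset_of_support_le {Z : Set (ℝ × ℝ)} (hZ : IsBody Z) {S : Set (ℝ × ℝ)}
    (h : ∀ u, ∀ x ∈ S, dot u x ≤ support Z u) : S ⊆ Z := by
  intro x hx
  by_contra hxZ
  obtain ⟨f, t, h1, h2⟩ := geometric_hahn_banach_closed_point hZ.convex hZ.isCompact.isClosed hxZ
  have hf : ∀ y, f y = dot (f (1, 0), f (0, 1)) y := fun y =>
    DFunLike.congr_fun (eq_dot (f : (ℝ × ℝ) →ₗ[ℝ] ℝ)) y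
  obtain ⟨z, hz, hz'⟩ := exists_support hZ (f (1, 0), f (0, 1))
  have h3 := h (f (1, 0), f (0, 1)) x hx
  have h4 := h1 z hz
  rw [hf] at h2 h4
  linarith

theorem support_smul_set (hB : IsBody B) {c : ℝ} (hc : 0 ≤ c) (u : ℝ × ℝ) :
    support (c • B) u = c * support B u := by
  obtain ⟨x, ⟨y, hy, rfl⟩, h⟩ := exists_support (hB.smul c) u
  obtain ⟨z, hz, h'⟩ := exists_support hB u
  apply le_antisymm
  · rw [← h]
    simp only [map_smul, smul_eq_mul]
    exact mul_le_mul_of_nonneg_left (le_support hB u hy) hc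
  · rw [← h', ← smul_eq_mul, ← map_smul]
    exact le_support (hB.smul c) _ ⟨z, hz, rfl⟩

end support

theorem support_zonotope {ι : Type*} (s : Finset ι) (g : ι → ℝ × ℝ) (u : ℝ × ℝ) :
    support (zonotope s g) u = ∑ i ∈ s, |dot u (g i)| := by
  obtain ⟨x, hx, h⟩ := exists_support (isBody_zonotope s g) u
  obtain ⟨y, hy, h'⟩ := exists_mem_zonotope s g (dot u)
  apply le_antisymm
  · rw [← h]
    exact le_sum_of_mem_zonotope hx _
  · rw [← h']
    exact le_support (isBody_zonotope s g) u hy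

/-! ### Circumscribed zonotopes -/

/-- The unit vector with angle `k * π / N`. -/
noncomputable def direction (N : ℕ) (k : ℤ) : ℝ × ℝ :=
  (Real.cos (k * (Real.pi / N)), Real.sin (k * (Real.pi / N)))

theorem direction_add_period {N : ℕ} (hN : N ≠ 0) (k : ℤ) :
    direction N (k + N) = -direction N k := by
  have hN' : (N : ℝ) ≠ 0 := by exact_mod_cast hN
  have : ((k + N : ℤ) : ℝ) * (Real.pi / N) = k * (Real.pi / N) + Real.pi := by
    push_cast; field_simp
  ext <;> simp only [direction, this, Prod.fst_neg, Prod.snd_neg, Real.cos_add_pi, Real.sin_add_pi]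

theorem direction_succ_add_pred (N : ℕ) (k : ℤ) :
    direction N (k + 1) + direction N (k - 1) = (2 * Real.cos (Real.pi / N)) • direction N k := by
  ext <;> simp only [direction, Prod.fst_add, Prod.snd_add, Prod.smul_fst, Prod.smul_snd,
    smul_eq_mul, Int.cast_add, Int.cast_sub, Int.cast_one, add_mul, sub_mul, one_mul, Real.cos_add,
    Real.cos_sub, Real.sin_add, Real.sin_sub] <;> ring

theorem exists_direction_cone {N : ℕ} (hN : 2 ≤ N) (f : ℝ × ℝ) : ∃ (k : ℤ) (α β : ℝ),
    0 ≤ α ∧ 0 ≤ β ∧ f = α • direction N k + β • direction N (k + 1) := by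
  have hN' : (2 : ℝ) ≤ N := by exact_mod_cast hN
  have hδ : 0 < Real.pi / N := by positivity
  have hδ' : Real.pi / N < Real.pi := div_lt_self Real.pi_pos (by linarith)
  set δ := Real.pi / N with hδdef
  set z : ℂ := ⟨f.1, f.2⟩ with hz
  have h1 : f.1 = ‖z‖ * Real.cos z.arg := (Complex.norm_mul_cos_arg z).symm
  have h2 : f.2 = ‖z‖ * Real.sin z.arg := (Complex.norm_mul_sin_arg z).symm
  set φ := z.arg
  set k := ⌊φ / δ⌋
  have hk1 : k * δ ≤ φ := (le_div_iff₀ hδ).1 (Int.floor_le _)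
  have hk2 : φ ≤ (k + 1) * δ := ((div_lt_iff₀ hδ).1 (Int.lt_floor_add_one _)).le
  have hs : 0 < Real.sin δ := Real.sin_pos_of_pos_of_lt_pi hδ hδ'
  -- The coefficients come from the sine rule in the parallelogram with diagonal `f` and sides along
  -- the two directions enclosing it.
  refine ⟨k, ‖z‖ * Real.sin ((k + 1) * δ - φ) / Real.sin δ, ‖z‖ * Real.sin (φ - k * δ) / Real.sin δ,
    div_nonneg (mul_nonneg (norm_nonneg _) (Real.sin_nonneg_of_nonneg_of_le_pi (by linarith)
      (by nlinarith))) hs.le,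
    div_nonneg (mul_nonneg (norm_nonneg _) (Real.sin_nonneg_of_nonneg_of_le_pi (by linarith)
      (by nlinarith))) hs.le, ?_⟩
  have e1 : ((k + 1 : ℤ) : ℝ) * δ = k * δ + δ := by push_cast; ring
  have e2 : ((k : ℝ) + 1) * δ = k * δ + δ := by ring
  have hsc := Real.sin_sq_add_cos_sq (k * δ)
  simp only [direction, ← hδdef]
  rw [e1, e2]
  clear e1 e2 hk1 hk2
  generalize (k : ℝ) * δ = A at *
  ext
  · simp only [Prod.fst_add, Prod.smul_fst, smul_eq_mul]
    rw [h1]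
    field_simp
    simp only [Real.sin_sub, Real.sin_add, Real.cos_add]
    linear_combination (-‖z‖ * Real.cos φ * Real.sin δ) * hsc
  · simp only [Prod.snd_add, Prod.smul_snd, smul_eq_mul]
    rw [h2]
    field_simp
    simp only [Real.sin_sub, Real.sin_add, Real.cos_add]
    linear_combination (-‖z‖ * Real.sin φ * Real.sin δ) * hsc

/-- The zeros of sine are grid points, so sine does not change sign between neighbouring ones.
Reducing `m` modulo `N` moves both angles into `[0, π]` with a common sign. -/
theorem sin_mul_sin_succ_nonneg {N : ℕ} (hN : N ≠ 0) (m : ℤ) :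
    0 ≤ Real.sin (m * (Real.pi / N)) * Real.sin ((m + 1 : ℤ) * (Real.pi / N)) := by
  have hN' : (0 : ℝ) < N := by exact_mod_cast Nat.pos_of_ne_zero hN
  have hNz : (N : ℤ) ≠ 0 := by exact_mod_cast hN
  set q := m / N
  set r := m % N with hr
  have h0 : (0 : ℝ) ≤ r := by exact_mod_cast Int.emod_nonneg m hNz
  have h1 : (r : ℝ) + 1 ≤ N := by
    exact_mod_cast Int.emod_lt_of_pos m (by omega : (0 : ℤ) < N)
  have hm : (m : ℝ) = r + N * q := by exact_mod_cast (Int.emod_add_mul_ediv m N).symm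
  have e1 : (m : ℝ) * (Real.pi / N) = r * (Real.pi / N) + q * Real.pi := by
    rw [hm]; field_simp
  have e2 : ((m + 1 : ℤ) : ℝ) * (Real.pi / N) = (r + 1) * (Real.pi / N) + q * Real.pi := by
    push_cast; rw [hm]; field_simp; ring
  have hp : ∀ t : ℝ, 0 ≤ t → t ≤ N → 0 ≤ Real.sin (t * (Real.pi / N)) := fun t ht ht' =>
    Real.sin_nonneg_of_nonneg_of_le_pi (by positivity) (by
      rw [← mul_div_assoc, div_le_iff₀ hN', mul_comm]
      exact mul_le_mul_of_nonneg_left ht' Real.pi_pos.le)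
  rw [e1, e2, Real.sin_add_int_mul_pi, Real.sin_add_int_mul_pi]
  have hq : ((-1 : ℝ) ^ q) * (-1) ^ q = 1 := by
    rw [← mul_zpow]; simp
  calc (0 : ℝ) ≤ Real.sin (r * (Real.pi / N)) * Real.sin ((r + 1) * (Real.pi / N)) :=
        mul_nonneg (hp _ h0 (by linarith)) (hp _ (by linarith) h1)
    _ = (((-1 : ℝ) ^ q) * (-1) ^ q) *
          (Real.sin (r * (Real.pi / N)) * Real.sin ((r + 1) * (Real.pi / N))) := by rw [hq, one_mul]
    _ = _ := by ring

theorem sum_range_eq_of_periodic {N : ℕ} {G : ℤ → ℝ} (hG : ∀ k, G (k + N) = G k) (k : ℤ) :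
    ∑ m ∈ Finset.range N, G (k + m) = ∑ m ∈ Finset.range N, G m := by
  have step : ∀ k : ℤ, ∑ m ∈ Finset.range N, G (k + 1 + m) = ∑ m ∈ Finset.range N, G (k + m) := by
    intro k
    have h1 := Finset.sum_range_succ (fun m : ℕ => G (k + m)) N
    have h2 := Finset.sum_range_succ' (fun m : ℕ => G (k + m)) N
    rw [h1, hG] at h2
    simp only [Nat.cast_add, Nat.cast_one, Nat.cast_zero, add_zero] at h2
    rw [add_right_cancel h2]
    exact Finset.sum_congr rfl fun m _ => by congr 1; ring
  induction k using Int.induction_on with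
  | zero => simp
  | succ i ih => rw [step, ih]
  | pred i ih => rw [← ih, ← step]; simp

/-- The discrete second difference of the support function in the directions `k * π / N`. -/
noncomputable def edgeWeight (B : Set (ℝ × ℝ)) (N : ℕ) (k : ℤ) : ℝ :=
  support B (direction N (k + 1)) + support B (direction N (k - 1)) -
    2 * Real.cos (Real.pi / N) * support B (direction N k)

/-- Half of the edge with normal direction `k * π / N` of the polygon circumscribed to `B`. -/
noncomputable def halfEdge (B : Set (ℝ × ℝ)) (N : ℕ) (k : ℤ) : ℝ × ℝ :=
  (edgeWeight B N k / (2 * Real.sin (Real.pi / N))) •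
    (-Real.sin (k * (Real.pi / N)), Real.cos (k * (Real.pi / N)))

theorem dot_direction_halfEdge (B : Set (ℝ × ℝ)) (N : ℕ) (k j : ℤ) :
    dot (direction N k) (halfEdge B N j) =
      edgeWeight B N j / (2 * Real.sin (Real.pi / N)) * Real.sin ((k - j : ℤ) * (Real.pi / N)) := by
  simp only [dot_apply, direction, halfEdge, Prod.smul_mk, smul_eq_mul, Int.cast_sub, sub_mul,
    Real.sin_sub]
  ring

/-- The zonotope circumscribed to `B` with normal directions `k * π / N`. -/
noncomputable def circumscribed (B : Set (ℝ × ℝ)) (N : ℕ) : Set (ℝ × ℝ) :=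
  zonotope (Finset.range N) fun j => halfEdge B N j

section circumscribed

variable {B : Set (ℝ × ℝ)} {N : ℕ}

/-- The sum of the two neighbours of a direction is `2 cos (π / N)` times that direction, so this is
subadditivity of the support function. -/
theorem edgeWeight_nonneg (hB : IsBody B) (hN : 2 ≤ N) (k : ℤ) : 0 ≤ edgeWeight B N k := by
  have hN' : (2 : ℝ) ≤ N := by exact_mod_cast hN
  have hc : 0 ≤ 2 * Real.cos (Real.pi / N) := by
    have : Real.pi / N ≤ Real.pi / 2 := by gcongr
    have h0 : 0 ≤ Real.pi / N := by positivity
    exact mul_nonneg zero_le_two (Real.cos_nonneg_of_neg_pi_div_two_le_of_le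
      (by linarith [Real.pi_pos]) this)
  rw [edgeWeight, ← support_smul hB hc, ← direction_succ_add_pred]
  linarith [support_add_le hB (direction N (k + 1)) (direction N (k - 1))]

theorem support_direction_add_period (hB : IsBody B) (hneg : -B = B) (hN : N ≠ 0) (k : ℤ) :
    support B (direction N (k + N)) = support B (direction N k) := by
  rw [direction_add_period hN, support_neg hB hneg]

theorem edgeWeight_add_period (hB : IsBody B) (hneg : -B = B) (hN : N ≠ 0) (k : ℤ) :
    edgeWeight B N (k + N) = edgeWeight B N k := by
  rw [edgeWeight, edgeWeight, ← support_direction_add_period hB hneg hN (k + 1),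
    ← support_direction_add_period hB hneg hN (k - 1), ← support_direction_add_period hB hneg hN k]
  congr 4 <;> ring_nf

theorem sum_edgeWeight_mul_sin (hB : IsBody B) (hneg : -B = B) (hN : N ≠ 0) (k : ℤ) :
    ∑ m ∈ Finset.range N, edgeWeight B N (k + m) * Real.sin (m * (Real.pi / N)) =
      2 * Real.sin (Real.pi / N) * support B (direction N k) := by
  have hN' : (N : ℝ) ≠ 0 := by exact_mod_cast hN
  set δ := Real.pi / N with hδ
  -- A discrete Wronskian: `sin (m δ)` is annihilated by the second difference that defines
  -- `edgeWeight`, so the sum telescopes. Symmetry of `B` identifies the boundary values at `m = 0`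
  -- and `m = N`.
  let T : ℕ → ℝ := fun m => support B (direction N (k + m)) * Real.sin (m * δ - δ) -
    support B (direction N (k + m - 1)) * Real.sin (m * δ)
  have key : ∀ m : ℕ, edgeWeight B N (k + m) * Real.sin (m * δ) = T (m + 1) - T m := by
    intro m
    have h1 : ((m + 1 : ℕ) : ℝ) * δ = m * δ + δ := by push_cast; ring
    have h2 : k + ((m + 1 : ℕ) : ℤ) = k + m + 1 := by push_cast; ring
    have h3 : T (m + 1) = support B (direction N (k + m + 1)) * Real.sin (m * δ) -
        support B (direction N (k + m)) * Real.sin (m * δ + δ) := by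
      simp only [T]
      rw [h1, h2, add_sub_cancel_right, add_sub_cancel_right]
    rw [h3, edgeWeight, ← hδ]
    simp only [T, Real.sin_add, Real.sin_sub]
    ring
  have h1 : (N : ℝ) * δ = Real.pi := by rw [hδ]; field_simp
  rw [Finset.sum_congr rfl fun m _ => key m, Finset.sum_range_sub]
  simp only [T, h1, support_direction_add_period hB hneg hN, Real.sin_pi_sub, Real.sin_pi,
    Nat.cast_zero, add_zero, zero_mul, zero_sub, Real.sin_neg, Real.sin_zero]
  ring

theorem support_circumscribed_direction (hB : IsBody B) (hneg : -B = B) (hN : 2 ≤ N) (k : ℤ) :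
    support (circumscribed B N) (direction N k) = support B (direction N k) := by
  have hN0 : N ≠ 0 := by omega
  have hN' : (2 : ℝ) ≤ N := by exact_mod_cast hN
  have hs : 0 < Real.sin (Real.pi / N) := Real.sin_pos_of_pos_of_lt_pi (by positivity)
    (div_lt_self Real.pi_pos (by linarith))
  let G : ℤ → ℝ := fun j => |dot (direction N k) (halfEdge B N j)|
  have hG : ∀ j, G j = edgeWeight B N j / (2 * Real.sin (Real.pi / N)) *
      |Real.sin ((k - j : ℤ) * (Real.pi / N))| := fun j => by
    simp only [G]
    rw [dot_direction_halfEdge, abs_mul, abs_of_nonneg]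
    exact div_nonneg (edgeWeight_nonneg hB hN j) (by positivity)
  have hGp : ∀ j, G (j + N) = G j := fun j => by
    rw [hG, hG, edgeWeight_add_period hB hneg hN0]
    have : ((k - (j + N) : ℤ) : ℝ) * (Real.pi / N) =
        ((k - j : ℤ) : ℝ) * (Real.pi / N) - Real.pi := by
      push_cast; field_simp; ring
    rw [this, Real.sin_sub_pi, abs_neg]
  have h := sum_range_eq_of_periodic hGp k
  rw [circumscribed, support_zonotope]
  change ∑ m ∈ Finset.range N, G m = _
  rw [← h]
  have h2 : ∀ m ∈ Finset.range N, G (k + m) =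
      edgeWeight B N (k + m) * Real.sin (m * (Real.pi / N)) / (2 * Real.sin (Real.pi / N)) := by
    intro m hm
    have hm' : (m : ℝ) ≤ N := by exact_mod_cast (Finset.mem_range.1 hm).le
    have hsm : 0 ≤ Real.sin (m * (Real.pi / N)) :=
      Real.sin_nonneg_of_nonneg_of_le_pi (by positivity) (by
        rw [← mul_div_assoc, div_le_iff₀ (by linarith), mul_comm]
        exact mul_le_mul_of_nonneg_left hm' Real.pi_pos.le)
    have h3 : ((k - (k + m) : ℤ) : ℝ) * (Real.pi / N) = -(m * (Real.pi / N)) := by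
      push_cast; ring
    rw [hG, h3, Real.sin_neg, abs_neg, abs_of_nonneg hsm]
    ring
  rw [Finset.sum_congr rfl h2, ← Finset.sum_div, sum_edgeWeight_mul_sin hB hneg hN0]
  field_simp

/-- Each edge pairs with two neighbouring directions with the same sign, so every absolute value in
the support function of the zonotope is linear on the cone between them. -/
theorem support_circumscribed_cone (hB : IsBody B) (hneg : -B = B) (hN : 2 ≤ N) (k : ℤ)
    {α β : ℝ} (hα : 0 ≤ α) (hβ : 0 ≤ β) :
    support (circumscribed B N) (α • direction N k + β • direction N (k + 1)) =
      α * support B (direction N k) + β * support B (direction N (k + 1)) := by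
  rw [← support_circumscribed_direction hB hneg hN, ← support_circumscribed_direction hB hneg hN,
    circumscribed, support_zonotope, support_zonotope, support_zonotope, Finset.mul_sum,
    Finset.mul_sum, ← Finset.sum_add_distrib]
  refine Finset.sum_congr rfl fun j _ => ?_
  rw [dot_add_left, dot_smul_left, dot_smul_left]
  have h : 0 ≤ dot (direction N k) (halfEdge B N j) * dot (direction N (k + 1)) (halfEdge B N j) := by
    rw [dot_direction_halfEdge, dot_direction_halfEdge, mul_mul_mul_comm, ← sq]
    have := sin_mul_sin_succ_nonneg (by omega : N ≠ 0) (k - j)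
    rw [show k - j + 1 = k + 1 - j by ring] at this
    positivity
  rcases mul_nonneg_iff.1 h with ⟨h1, h2⟩ | ⟨h1, h2⟩
  · rw [abs_of_nonneg h1, abs_of_nonneg h2, abs_of_nonneg (by positivity)]
  · rw [abs_of_nonpos h1, abs_of_nonpos h2, abs_of_nonpos (by nlinarith)]
    ring

theorem subset_circumscribed (hB : IsBody B) (hneg : -B = B) (hN : 2 ≤ N) :
    B ⊆ circumscribed B N := by
  refine subset_of_support_le (isBody_zonotope _ _) fun f x hx => (le_support hB f hx).trans ?_
  obtain ⟨k, α, β, hα, hβ, rfl⟩ := exists_direction_cone hN f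
  change _ ≤ support (circumscribed B N) _
  rw [support_circumscribed_cone hB hneg hN k hα hβ, ← support_smul hB hα, ← support_smul hB hβ]
  exact support_add_le hB _ _

/-- On a cone, the support function of the zonotope interpolates that of `B` linearly. Neighbouring
directions differ by `O(1 / N)`, so the error is `O(R / N)`, and the inner radius `r` makes it
relative to the support function of `B`. -/
theorem circumscribed_subset (hB : IsBody B) (hneg : -B = B) (hN : 3 ≤ N) {r R : ℝ} (hr : 0 < r)
    (hrB : Metric.closedBall 0 r ⊆ B) (hR : ∀ x ∈ B, ‖x‖ ≤ R) :
    circumscribed B N ⊆ (1 + 4 * Real.pi * R / r / N) • B := by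
  have hN' : (3 : ℝ) ≤ N := by exact_mod_cast hN
  have hN0 : (0 : ℝ) < N := by linarith
  have hR0 : 0 ≤ R := (norm_nonneg _).trans (hR _ hB.nonempty.choose_spec)
  have hc : 1 / 2 ≤ Real.cos (Real.pi / N) := by
    rw [← Real.cos_pi_div_three]
    exact Real.cos_le_cos_of_nonneg_of_le_pi (by positivity) (by linarith [Real.pi_pos])
      (by gcongr)
  refine subset_of_support_le (hB.smul _) fun f x hx =>
    (le_support (isBody_zonotope _ _) f hx).trans ?_
  rw [support_smul_set hB (by positivity)]
  obtain ⟨k, α, β, hα, hβ, hf⟩ := exists_direction_cone (by omega : 2 ≤ N) f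
  have hZ := support_circumscribed_cone hB hneg (by omega : 2 ≤ N) k hα hβ
  rw [← hf, circumscribed] at hZ
  rw [hZ]
  set u := direction N k with hu
  set v := direction N (k + 1) with hv
  set D := 2 * R * (Real.pi / N) with hD
  have hD0 : 0 ≤ D := by positivity
  have hang : |((k + 1 : ℤ) : ℝ) * (Real.pi / N) - k * (Real.pi / N)| = Real.pi / N := by
    push_cast
    rw [add_mul, one_mul, add_sub_cancel_left, abs_of_nonneg (by positivity)]
  have huv : support B (v - u) ≤ D := by
    refine (support_le_mul hB hR _).trans ?_
    have h1 : |(v - u).1| ≤ Real.pi / N := by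
      rw [← hang]; exact Real.abs_cos_sub_cos_le _ _
    have h2 : |(v - u).2| ≤ Real.pi / N := by
      rw [← hang]; exact Real.abs_sin_sub_sin_le _ _
    calc R * (|(v - u).1| + |(v - u).2|) ≤ R * (Real.pi / N + Real.pi / N) := by gcongr
      _ = D := by rw [hD]; ring
  have hvu : support B (u - v) ≤ D := by
    rw [← neg_sub, support_neg hB hneg]; exact huv
  have h1 : (α + β) * support B u ≤ support B f + β * D := by
    rw [← support_smul hB (add_nonneg hα hβ),
      show (α + β) • u = f + β • (u - v) by rw [hf]; module]
    refine (support_add_le hB _ _).trans ?_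
    rw [support_smul hB hβ]
    gcongr
  have h2 : (α + β) * support B v ≤ support B f + α * D := by
    rw [← support_smul hB (add_nonneg hα hβ),
      show (α + β) • v = f + α • (v - u) by rw [hf]; module]
    refine (support_add_le hB _ _).trans ?_
    rw [support_smul hB hα]
    gcongr
  have h3 : r * ((α + β) / 2) ≤ support B f := by
    have hmem : r • u ∈ B := hrB (by
      rw [mem_closedBall_zero_iff, norm_smul, Real.norm_of_nonneg hr.le]
      -- The norm of `ℝ × ℝ` is the maximum norm.
      have : ‖u‖ ≤ 1 := by
        rw [Prod.norm_def]
        exact max_le (Real.abs_cos_le_one _) (Real.abs_sin_le_one _)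
      nlinarith)
    refine le_trans ?_ (le_support hB f hmem)
    have huu : dot u u = 1 := by
      rw [dot_apply, hu, direction, ← sq, ← sq, Real.cos_sq_add_sin_sq]
    have hvu' : dot v u = Real.cos (Real.pi / N) := by
      have : Real.pi / N = ((k + 1 : ℤ) : ℝ) * (Real.pi / N) - k * (Real.pi / N) := by
        push_cast; ring
      rw [dot_apply, hu, hv, direction, direction]
      conv_rhs => rw [this, Real.cos_sub]
    rw [map_smul, smul_eq_mul, hf, dot_add_left, dot_smul_left, dot_smul_left, huu, hvu']
    gcongr
    nlinarith
  rcases eq_or_lt_of_le (add_nonneg hα hβ) with h0 | h0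
  · have hα0 : α = 0 := by linarith
    have hβ0 : β = 0 := by linarith
    rw [hα0, hβ0] at h3 ⊢
    simp only [zero_mul, add_zero]
    have : 0 ≤ support B f := by linarith
    positivity
  · have h4 : α * support B u + β * support B v ≤ support B f + (α + β) * D := by
      refine le_of_mul_le_mul_left ?_ h0
      nlinarith [mul_le_mul_of_nonneg_left h1 hα, mul_le_mul_of_nonneg_left h2 hβ,
        mul_nonneg (mul_nonneg hα hα) hD0, mul_nonneg (mul_nonneg hβ hβ) hD0]
    refine h4.trans ?_
    have h5 : 4 * Real.pi * R / r / N = 2 * D / r := by rw [hD]; field_simp; ring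
    rw [h5, add_mul 1, one_mul, add_le_add_iff_left, div_mul_eq_mul_div, le_div_iff₀ hr]
    nlinarith [mul_le_mul_of_nonneg_left h3 hD0]

end circumscribed

theorem exists_mixedAdditive_approx {B : Set (ℝ × ℝ)} (hB : IsBody B) (hneg : -B = B)
    (hint : (0 : ℝ × ℝ) ∈ interior B) {ε : ℝ} (hε : 0 < ε) :
    ∃ Z, IsBody Z ∧ -Z = Z ∧ MixedAdditive Z ∧ B ⊆ Z ∧ Z ⊆ (1 + ε) • B := by
  obtain ⟨r, hr, hrB⟩ := Metric.nhds_basis_closedBall.mem_iff.1 (mem_interior_iff_mem_nhds.1 hint)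
  obtain ⟨R, hR⟩ := hB.isCompact.isBounded.exists_norm_le
  -- Below, `N + 3` directions are used, so that the angle is at most `π / 3`.
  obtain ⟨N, hN⟩ := exists_nat_gt (4 * Real.pi * R / r / ε)
  have h0 : (0 : ℝ × ℝ) ∈ B := interior_subset hint
  have hM : 0 < ((N + 3 : ℕ) : ℝ) := by positivity
  refine ⟨circumscribed B (N + 3), isBody_zonotope _ _, neg_zonotope _ _,
    mixedAdditive_zonotope _ _, subset_circumscribed hB hneg (by omega),
    (circumscribed_subset hB hneg (by omega) hr hrB hR).trans ?_⟩
  have hR0 : 0 ≤ R := (norm_nonneg _).trans (hR _ h0)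
  have hle : 4 * Real.pi * R / r / (N + 3 : ℕ) ≤ ε := by
    rw [div_le_iff₀ hM]
    rw [div_lt_iff₀ hε] at hN
    push_cast
    nlinarith
  rintro _ ⟨x, hx, rfl⟩
  have h1 : 0 < 1 + ε := by positivity
  refine ⟨((1 + 4 * Real.pi * R / r / (N + 3 : ℕ)) / (1 + ε)) • x, ?_, ?_⟩
  · refine hB.convex.smul_mem_of_zero_mem h0 hx ⟨by positivity, ?_⟩
    rw [div_le_one h1]
    linarith
  · simp only [smul_smul]
    rw [mul_div_cancel₀ _ h1.ne']

/-- For a planar body `K` and a symmetric body `B`, Minkowski's inequality holds with the difference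
body `K - K` in place of `K`. -/
theorem sqrt_le_mixed {K B : Set (ℝ × ℝ)} (hK : IsBody K) (hB : IsBody B) (hneg : -B = B)
    (hint : (0 : ℝ × ℝ) ∈ interior B) :
    √(volume.real (K + -K) * volume.real B) ≤
      volume.real (K + B) - volume.real K - volume.real B := by
  have key : ∀ ε : ℝ, 0 < ε → √(volume.real (K + -K) * volume.real B) ≤
      (1 + ε) ^ 2 * volume.real (K + B) - volume.real K - volume.real B := by
    intro ε hε
    obtain ⟨Z, hZ, hZneg, hZadd, hBZ, hZB⟩ := exists_mixedAdditive_approx hB hneg hint hε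
    have h1 := sqrt_le_mixed_of_mixedAdditive hK hZ hZneg hZadd
    have h2 : volume.real B ≤ volume.real Z :=
      measureReal_mono hBZ hZ.isCompact.measure_lt_top.ne
    have h3 : √(volume.real (K + -K) * volume.real B) ≤
        √(volume.real (K + -K) * volume.real Z) := by gcongr
    have h4 : volume.real (K + Z) ≤ (1 + ε) ^ 2 * volume.real (K + B) := by
      obtain ⟨x, hx⟩ := hK.nonempty
      -- Translated by `ε x` with `x ∈ K`, the sum `K + (1 + ε) B` fits into `(1 + ε)(K + B)`,
      -- because `(y + ε x) / (1 + ε)` is again in `K`.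
      have hsub : K + Z ⊆ (fun y => ε • x + y) ⁻¹' ((1 + ε) • (K + B)) := by
        rintro _ ⟨y, hy, z, hz, rfl⟩
        obtain ⟨b, hb, rfl⟩ := hZB hz
        have hmem : (1 / (1 + ε)) • y + (ε / (1 + ε)) • x ∈ K :=
          hK.convex hy hx (by positivity) (by positivity) (by field_simp)
        refine ⟨_, ⟨_, hmem, b, hb, rfl⟩, ?_⟩
        simp only [smul_add, smul_smul]
        rw [mul_one_div_cancel (by positivity), mul_div_cancel₀ _ (by positivity), one_smul]
        abel
      have htop : volume ((1 + ε) • (K + B)) ≠ ⊤ :=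
        ((hK.add hB).smul (1 + ε)).isCompact.measure_lt_top.ne
      have h5 := measureReal_mono (μ := volume) hsub (by rwa [measure_preimage_add])
      rw [measureReal_def (s := _ ⁻¹' _), measure_preimage_add, Measure.addHaar_smul,
        ENNReal.toReal_mul, ENNReal.toReal_ofReal (abs_nonneg _), abs_of_nonneg (by positivity),
        Module.finrank_prod, Module.finrank_self, ← measureReal_def] at h5
      exact h5
    linarith
  have hlim : Filter.Tendsto (fun ε : ℝ => (1 + ε) ^ 2 * volume.real (K + B) - volume.real K -
      volume.real B) (nhdsWithin 0 (Ioi 0))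
      (nhds ((1 + 0) ^ 2 * volume.real (K + B) - volume.real K - volume.real B)) :=
    Filter.Tendsto.mono_left (Continuous.tendsto (by fun_prop) 0) nhdsWithin_le_nhds
  have := ge_of_tendsto hlim (eventually_nhdsWithin_of_forall fun ε hε => key ε hε)
  simpa using this

/-- The image is an interval, whose length is the maximum minus the minimum of the form on `K`. -/
theorem volume_real_image_dot {K : Set (ℝ × ℝ)} (hK : IsBody K) (u : ℝ × ℝ) :
    volume.real (dot u '' K) = support (K + -K) u := by
  have hI : IsBody (dot u '' K) := hK.image _ (continuous_dot u)
  obtain ⟨p, q, hpq, h⟩ := hI.exists_eq_Icc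
  obtain ⟨x, hx, rfl⟩ : p ∈ dot u '' K := h ▸ left_mem_Icc.2 hpq
  obtain ⟨y, hy, rfl⟩ : q ∈ dot u '' K := h ▸ right_mem_Icc.2 hpq
  rw [h, Real.volume_real_Icc_of_le hpq]
  have hD := hK.add hK.neg
  apply le_antisymm
  · rw [sub_eq_add_neg, ← map_neg, ← map_add]
    exact le_support hD u ⟨y, hy, -x, Set.neg_mem_neg.2 hx, rfl⟩
  · obtain ⟨_, ⟨a, ha, c, hc, rfl⟩, h'⟩ := exists_support hD u
    have h1 : dot u a ∈ Icc (dot u x) (dot u y) := h ▸ mem_image_of_mem _ ha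
    have h2 : dot u (-c) ∈ Icc (dot u x) (dot u y) := h ▸ mem_image_of_mem _ hc
    rw [← h']
    simp only [map_add, map_neg, mem_Icc] at *
    linarith

theorem volume_real_smul (c : ℝ) (K : Set (ℝ × ℝ)) :
    volume.real (c • K) = c ^ 2 * volume.real K := by
  rw [measureReal_def, Measure.addHaar_smul, ENNReal.toReal_mul,
    ENNReal.toReal_ofReal (abs_nonneg _), Module.finrank_prod, Module.finrank_self,
    one_add_one_eq_two, measureReal_def, abs_of_nonneg (by positivity)]

/-- The quarter turn of the plane. -/
def quarterTurn : (ℝ × ℝ) →ₗ[ℝ] (ℝ × ℝ) :=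
  (LinearMap.snd ℝ ℝ ℝ).prod (-LinearMap.fst ℝ ℝ ℝ)

theorem volume_real_image_quarterTurn (K : Set (ℝ × ℝ)) :
    volume.real (quarterTurn '' K) = volume.real K := by
  have : LinearMap.det quarterTurn = 1 := by
    rw [← LinearMap.det_toMatrix (Module.Basis.finTwoProd ℝ), Matrix.det_fin_two]
    simp [LinearMap.toMatrix_apply, quarterTurn]
  rw [volume_real_image, this, abs_one, one_mul]

end Planar

/-! ### Mixed volumes and projection bodies in coordinates -/

namespace ConvexVolume

open Planar

theorem omega_two : omega 2 = Real.pi := by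
  rw [omega, EuclideanSpace.volume_closedBall_fin_two]
  simp [Real.pi_pos.le]

theorem omega_one : omega 1 = 2 := by
  rw [omega, EuclideanSpace.volume_closedBall]
  have h : Real.Gamma (1 / 2 + 1) = √Real.pi / 2 := by
    rw [Real.Gamma_add_one (by norm_num), Real.Gamma_one_half_eq]; ring
  have hpi : √Real.pi ≠ 0 := (Real.sqrt_pos.2 Real.pi_pos).ne'
  rw [Fintype.card_fin, Nat.cast_one, h, ENNReal.ofReal_one, one_pow, one_mul, pow_one,
    ENNReal.toReal_ofReal (by positivity)]
  field_simp

section plane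

variable {V : Type*} [AddCommGroup V] [Module ℝ V] (b : Module.Basis (Fin 2) ℝ V)

/-- The coordinates of a basis of a plane, as a pair. -/
noncomputable def coordPair : V ≃ₗ[ℝ] ℝ × ℝ := b.equivFun.trans (LinearEquiv.finTwoArrow ℝ ℝ)

theorem coordPair_apply (x : V) : coordPair b x = (b.equivFun x 0, b.equivFun x 1) := rfl

theorem volume_image_finTwoArrow (S : Set (Fin 2 → ℝ)) :
    volume ((LinearEquiv.finTwoArrow ℝ ℝ) '' S) = volume S := by
  have h := (volume_preserving_finTwoArrow ℝ).symm.measure_preimage_equiv S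
  rw [← h]
  congr 1
  exact (MeasurableEquiv.finTwoArrow (α := ℝ)).toEquiv.image_eq_preimage_symm S

theorem vol_eq (S : Set V) : vol b S = volume.real (coordPair b '' S) := by
  rw [vol, measureReal_def, ← volume_image_finTwoArrow, image_image]
  rfl

theorem vol_parallelepiped (x : Fin 2 → V) :
    vol b (parallelepiped x) = |(coordPair b (x 0)).1 * (coordPair b (x 1)).2 -
      (coordPair b (x 0)).2 * (coordPair b (x 1)).1| := by
  have h : b.equivFun '' parallelepiped x =
      Matrix.toLin' (Matrix.of fun i j => b.equivFun (x j) i) '' Icc 0 1 := by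
    rw [parallelepiped, image_image]
    refine image_congr fun t _ => ?_
    ext i
    simp [Matrix.mulVec, dotProduct, Fin.sum_univ_two, mul_comm]
  rw [vol, h, Measure.addHaar_image_linearMap, LinearMap.det_toLin', Matrix.det_fin_two,
    Real.volume_Icc_pi]
  simp [coordPair_apply]
  congr 1
  ring

theorem mixedVolumeIdx_one_eq (K L : Set V) : mixedVolumeIdx b 1 K L =
    (vol b (K + L) - vol b K - vol b L) / 2 := by
  have h : (Finset.univ.filter fun S : Finset (Fin 2) => S.Nonempty) = {{0}, {1}, {0, 1}} := by
    decide
  rw [mixedVolumeIdx, mixedVolume, h, Finset.sum_insert (by decide), Finset.sum_insert (by decide),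
    Finset.sum_singleton]
  simp
  ring

theorem vol_line {W : Type*} [AddCommGroup W] [Module ℝ W] (c : Module.Basis (Fin 1) ℝ W)
    (S : Set W) : vol c S = volume.real ((fun q => c.equivFun q 0) '' S) := by
  have h := (volume_preserving_funUnique (Fin 1) ℝ).symm.measure_preimage_equiv (c.equivFun '' S)
  rw [← MeasurableEquiv.image_eq_preimage_symm, image_image] at h
  rw [vol, measureReal_def]
  congr 1
  convert h.symm
  rfl

/-- The volume of the projection of a planar set along `v`, computed with any basis of the quotient,
is the length of its image under `x ↦ det (v, x)`. -/
theorem projection_measure {d : ℕ} (hd : d = 1) {v : V}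
    (c : Module.Basis (Fin d) ℝ (V ⧸ Submodule.span ℝ {v})) (w : Fin d → V)
    (hw : ∀ i, Submodule.mkQ (Submodule.span ℝ {v}) (w i) = c i) (K : Set V) :
    vol b (parallelepiped (Fin.cons v w : Fin (d + 1) → V)) *
      vol c (Submodule.mkQ (Submodule.span ℝ {v}) '' K) =
    volume.real (dot (-(coordPair b v).2, (coordPair b v).1) '' (coordPair b '' K)) := by
  subst hd
  rw [vol_line, vol_parallelepiped, image_image]
  set u : ℝ × ℝ := (-(coordPair b v).2, (coordPair b v).1) with hu
  have hv : dot u (coordPair b v) = 0 := by rw [dot_apply]; ring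
  -- The form `x ↦ det (v, x)` kills `v`, so it descends to the quotient line, where it is its value
  -- at `w 0` times the coordinate; that value is, up to sign, the parallelepiped factor.
  have key : ∀ x, dot u (coordPair b x) = dot u (coordPair b (w 0)) *
      c.equivFun (Submodule.mkQ (Submodule.span ℝ {v}) x) 0 := by
    intro x
    set q := Submodule.mkQ (Submodule.span ℝ {v}) x with hq
    have h1 : q = c.equivFun q 0 • c 0 := by
      conv_lhs => rw [← c.sum_equivFun q]
      simp
    have h2 : x - c.equivFun q 0 • w 0 ∈ Submodule.span ℝ {v} := by
      rw [← Submodule.Quotient.mk_eq_zero, ← Submodule.mkQ_apply, map_sub, map_smul, hw, ← h1,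
        sub_self]
    obtain ⟨t, ht⟩ := Submodule.mem_span_singleton.1 h2
    have h3 : x = t • v + c.equivFun q 0 • w 0 := by rw [ht]; abel
    conv_lhs => rw [h3]
    simp only [map_add, map_smul, hv, smul_eq_mul, mul_zero, zero_add]
    ring
  have h4 : (coordPair b ((Fin.cons v w : Fin 2 → V) 0)).1 *
      (coordPair b ((Fin.cons v w : Fin 2 → V) 1)).2 -
      (coordPair b ((Fin.cons v w : Fin 2 → V) 0)).2 *
      (coordPair b ((Fin.cons v w : Fin 2 → V) 1)).1 = dot u (coordPair b (w 0)) := by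
    rw [dot_apply, hu, show (1 : Fin 2) = Fin.succ 0 from rfl, Fin.cons_succ, Fin.cons_zero]
    ring
  have h5 : dot u '' (coordPair b '' K) = dot u (coordPair b (w 0)) •
      ((fun x => c.equivFun (Submodule.mkQ (Submodule.span ℝ {v}) x) 0) '' K) := by
    rw [image_image, ← image_smul, image_image]
    exact image_congr fun x _ => key x
  rw [h4, h5, measureReal_def, measureReal_def, Measure.addHaar_smul, ENNReal.toReal_mul,
    ENNReal.toReal_ofReal (abs_nonneg _), Module.finrank_self, pow_one]

variable [FiniteDimensional ℝ V]

theorem projectionVolume_eq {v : V} (hv : v ≠ 0) {K : Set V} (hK : IsBody (coordPair b '' K)) :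
    projectionVolume b K v = support (coordPair b '' K + -(coordPair b '' K))
      (-(coordPair b v).2, (coordPair b v).1) := by
  rw [← volume_real_image_dot hK]
  refine projection_measure b ?_ _ _ (fun i => Function.surjInv_eq _ _) K
  have h1 := Submodule.finrank_quotient_add_finrank (Submodule.span ℝ {v})
  rw [finrank_span_singleton hv, Module.finrank_eq_card_basis b, Fintype.card_fin] at h1
  omega

/-- The support functions of `Π K` and of the turned `K - K` agree, and a compact convex set is
determined by its support function. The pair on the right is `ξ` in dual coordinates after a quarter
turn. -/
theorem mem_projectionBody_iff {K : Set V} (hK : IsBody (coordPair b '' K))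
    (ξ : Module.Dual ℝ V) : ξ ∈ projectionBody b K ↔
      (-ξ (b 1), ξ (b 0)) ∈ coordPair b '' K + -(coordPair b '' K) := by
  have hD := hK.add hK.neg
  have hξ : ∀ v, ξ v = dot (-(coordPair b v).2, (coordPair b v).1) (-ξ (b 1), ξ (b 0)) := by
    intro v
    conv_lhs => rw [← b.sum_equivFun v]
    simp only [Fin.sum_univ_two, map_add, map_smul, smul_eq_mul, dot_apply, coordPair_apply]
    ring
  constructor
  · intro h
    refine subset_of_support_le hD (S := {(-ξ (b 1), ξ (b 0))}) ?_ rfl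
    rintro u _ rfl
    -- `projectionBody` constrains only `v ≠ 0`; the inequality for the zero form is trivial.
    rcases eq_or_ne u 0 with rfl | hu
    · obtain ⟨x, hx⟩ := hD.nonempty
      have := le_support hD 0 hx
      simpa [dot_apply] using this
    · set v := (coordPair b).symm (u.2, -u.1) with hv
      have hv' : (-(coordPair b v).2, (coordPair b v).1) = u := by
        rw [hv, LinearEquiv.apply_symm_apply]; simp
      have hv0 : v ≠ 0 := by
        rintro h0
        rw [h0] at hv'
        exact hu (by rw [← hv']; simp)
      have := h v hv0
      rwa [projectionVolume_eq b hv0 hK, hξ, hv'] at this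
  · intro h v hv
    rw [projectionVolume_eq b hv hK, hξ]
    exact le_support hD _ h

theorem svol_prod_projectionBody (B : Set V) {K : Set V} (hK : IsBody (coordPair b '' K)) :
    svol b (B ×ˢ projectionBody b K) =
      vol b B * volume.real (coordPair b '' K + -(coordPair b '' K)) := by
  rw [svol, Set.prodMap_image_prod, Measure.volume_eq_prod, Measure.prod_prod, ENNReal.toReal_mul,
    vol, ← volume_real_image_quarterTurn, measureReal_def,
    ← volume_image_finTwoArrow (b.dualBasis.equivFun '' _), image_image]
  congr 3
  ext p
  simp only [mem_image]
  constructor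
  · rintro ⟨ξ, hξ, rfl⟩
    refine ⟨_, (mem_projectionBody_iff b hK ξ).1 hξ, ?_⟩
    simp [quarterTurn]
  · rintro ⟨y, hy, rfl⟩
    refine ⟨b.constr ℝ ![y.2, -y.1], (mem_projectionBody_iff b hK _).2 ?_, ?_⟩
    · simpa [Module.Basis.constr_basis] using hy
    · simp [quarterTurn]

end plane

theorem IsUnitBall.neg_eq {V : Type*} [AddCommGroup V] [Module ℝ V] [TopologicalSpace V] {B : Set V}
    (hB : IsUnitBall B) : -B = B :=
  Set.Subset.antisymm (fun x hx => by simpa using hB.neg_mem _ hx) fun x hx => hB.neg_mem x hx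

/-! ### The supremum in a plane and the value of the functional -/

section unitBall

variable {V : Type*} [AddCommGroup V] [Module ℝ V] [TopologicalSpace V]
  [IsTopologicalAddGroup V] [ContinuousSMul ℝ V] {B : Set V}

theorem IsUnitBall.zero_mem_interior (hB : IsUnitBall B) : (0 : V) ∈ interior B := by
  obtain ⟨x, hx⟩ := hB.interior_nonempty
  have hx' : -x ∈ interior B := by
    have h : -interior B ⊆ interior B :=
      interior_maximal (Set.neg_subset.2 (interior_subset.trans hB.neg_eq.ge))
        isOpen_interior.neg
    exact h (by simpa using hx)
  have := hB.convex.interior hx hx' (a := 1 / 2) (b := 1 / 2) (by norm_num) (by norm_num)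
    (by norm_num)
  simpa using this

theorem IsUnitBall.comap_subtype [T2Space V] [FiniteDimensional ℝ V] (hB : IsUnitBall B)
    (W : Submodule ℝ V) : IsUnitBall (W.subtype ⁻¹' B) where
  convex := hB.convex.linear_preimage W.subtype
  isCompact := by
    have h : Topology.IsClosedEmbedding (Subtype.val : W → V) :=
      W.closed_of_finiteDimensional.isClosedEmbedding_subtypeVal
    exact h.isCompact_preimage hB.isCompact
  neg_mem x hx := by simpa using hB.neg_mem _ hx
  interior_nonempty := ⟨0, preimage_interior_subset_interior_preimage
    (f := fun x : W => (x : V)) continuous_subtype_val (by simpa using hB.zero_mem_interior)⟩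

variable [T2Space V] [FiniteDimensional ℝ V]

/-- In a plane the supremum in the definition of `functional` is attained by multiples of `B`. -/
theorem isGreatest_svol (b : Module.Basis (Fin 2) ℝ V) (hB : IsUnitBall B) :
    IsGreatest {s : ℝ | ∃ L : ConvexBody V, mixedVolumeIdx b 1 (L : Set V) B = 1 ∧
      s = svol b (B ×ˢ projectionBody b (L : Set V))} 4 := by
  have hΦ : Continuous (coordPair b) :=
    (coordPair b : V →ₗ[ℝ] ℝ × ℝ).continuous_of_finiteDimensional
  have himage : ∀ L : ConvexBody V, IsBody (coordPair b '' (L : Set V)) := fun L =>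
    IsBody.image (coordPair b : V →ₗ[ℝ] ℝ × ℝ) hΦ ⟨L.nonempty, L.isCompact, L.convex⟩
  have hB0 : (0 : V) ∈ B := interior_subset hB.zero_mem_interior
  have hC : IsBody (coordPair b '' B) :=
    IsBody.image (coordPair b : V →ₗ[ℝ] ℝ × ℝ) hΦ ⟨⟨0, hB0⟩, hB.isCompact, hB.convex⟩
  have hCneg : -(coordPair b '' B) = coordPair b '' B := by
    conv_rhs => rw [← hB.neg_eq]
    exact (Set.image_neg (coordPair b : V →ₗ[ℝ] ℝ × ℝ) B).symm
  have hCint : (0 : ℝ × ℝ) ∈ interior (coordPair b '' B) := by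
    have h := (coordPair b).toContinuousLinearEquiv.toHomeomorph.image_interior B
    have h' : (0 : ℝ × ℝ) ∈ (coordPair b).toContinuousLinearEquiv.toHomeomorph '' interior B :=
      ⟨0, hB.zero_mem_interior, map_zero (coordPair b)⟩
    rw [h] at h'
    exact h'
  have hadd : ∀ K L : Set V, coordPair b '' (K + L) = coordPair b '' K + coordPair b '' L :=
    fun K L => Set.image_add (coordPair b : V →ₗ[ℝ] ℝ × ℝ)
  have hpos : 0 < volume.real (coordPair b '' B) :=
    ENNReal.toReal_pos (Measure.measure_pos_of_nonempty_interior _ ⟨0, hCint⟩).ne'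
      hC.isCompact.measure_lt_top.ne
  constructor
  · set a := volume.real (coordPair b '' B) with ha
    -- With `a` the area of `B`, the mixed area of `B / a` and `B` is 1, and the symplectic volume
    -- is `a * (2 / a)² * a = 4`.
    let L : ConvexBody V := ⟨(1 / a) • B, hB.convex.smul _, hB.isCompact.smul _,
      Set.Nonempty.smul_set ⟨0, hB0⟩⟩
    have hL : coordPair b '' (L : Set V) = (1 / a) • (coordPair b '' B) :=
      Set.image_smul_comm _ _ _ fun x => map_smul (coordPair b) _ x
    have hLC : (1 / a) • (coordPair b '' B) + coordPair b '' B =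
        (1 / a + 1) • (coordPair b '' B) := by
      rw [hC.convex.add_smul (by positivity) zero_le_one, one_smul]
    refine ⟨L, ?_, ?_⟩
    · rw [mixedVolumeIdx_one_eq, vol_eq, vol_eq, vol_eq, hadd, hL]
      rw [hLC, volume_real_smul, volume_real_smul, ← ha]
      field_simp
      ring
    · rw [svol_prod_projectionBody b B (himage L), hL, vol_eq, ← Set.smul_set_neg, hCneg,
        ← hC.convex.add_smul (by positivity) (by positivity), volume_real_smul, ← ha]
      field_simp
      norm_num
  · rintro _ ⟨L, hL, rfl⟩
    rw [mixedVolumeIdx_one_eq, vol_eq, vol_eq, vol_eq, hadd] at hL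
    rw [svol_prod_projectionBody b B (himage L), vol_eq, mul_comm]
    -- The right-hand side is twice the mixed area `V_1(L, B) = 1`, so squaring gives the bound 4.
    have h := sqrt_le_mixed (himage L) hC hCneg hCint
    rw [Real.sqrt_le_left (by linarith)] at h
    refine h.trans (le_of_eq ?_)
    rw [show ∀ x y z : ℝ, (x - y - z) = 2 * ((x - y - z) / 2) by intros; ring, hL]
    norm_num

/-- The dimension enters as an equation because `Module.finBasis` on a subspace is indexed by its
`finrank`, which equals 2 only propositionally. -/
theorem functional_eq_omega_two {n : ℕ} (hn : n = 2) (b : Module.Basis (Fin n) ℝ V)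
    (hB : IsUnitBall B) : functional b B = omega 2 := by
  subst hn
  rw [functional, (isGreatest_svol b hB).csSup_eq, omega_one, pow_one]
  ring

end unitBall

end ConvexVolume

end

theorem mainTheorem6 {V : Type*} [AddCommGroup V] [Module ℝ V] [TopologicalSpace V]
    [IsTopologicalAddGroup V] [ContinuousSMul ℝ V] [T2Space V] [FiniteDimensional ℝ V]
    (B : Set V) (hB : ConvexVolume.IsUnitBall B) :
    ConvexVolume.omega 2 = Real.pi ∧
    (∀ b : Module.Basis (Fin 2) ℝ V,
      ConvexVolume.functional b B = ConvexVolume.omega 2) ∧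
    (∀ a ∈ ConvexVolume.simpleVectors 2 V,
      ConvexVolume.inducedDensity ConvexVolume.centroidInvariant B 2 a =
        ConvexVolume.inducedDensity ConvexVolume.busemannInvariant B 2 a) := by
  refine ⟨ConvexVolume.omega_two, fun b => ConvexVolume.functional_eq_omega_two rfl b hB,
    fun a _ => ?_⟩
  unfold ConvexVolume.inducedDensity
  split_ifs with h
  · have h1 := ConvexVolume.functional_eq_omega_two h.2
      (Module.finBasis ℝ (ConvexVolume.multivectorSpan a))
      (hB.comap_subtype (ConvexVolume.multivectorSpan a))
    rw [ConvexVolume.topNorm, ConvexVolume.topNorm, ConvexVolume.centroidInvariant, h1,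
      ConvexVolume.busemannInvariant, h.2]
  · rfl
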